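/- For $i=1,\dots,m$ let $\mathcal X^i\subset\mathbb R^{v^i}$, let $P_0^i$ (the true input model) be a probability distribution on $\mathcal X^i$, and let $T^i\in\mathbb N$. For a measurable cost function $h:\prod_{i=1}^m(\mathcal X^i)^{T^i}\to\mathbb R$ and probability distributions $P^i$ on $\mathcal X^i$ put $$Z(P^1,\ldots,P^m)=E_{P^1,\ldots,P^m}[h(\mathbf X^1,\ldots,\mathbf X^m)],$$ where $\mathbf X^i=(X^i_t)_{t=1,\dots,T^i}$ consists of i.i.d. draws from $P^i$ and $\mathbf X^1,\ldots,\mathbf X^m$ are independent. Let $Z_0=Z(P_0^1,\ldots,P_0^m)$. For each $i$ let $y^i_1,y^i_2,\ldots$ be i.i.d. observations from a probability distribution $Q^i$ on $\mathcal X^i$, independent across $i$. Assume that $h$ is bounded a.s.: there is $M<\infty$ such that almost surely $|h|\le M$ at every argument all of whose entries are observations ($X_t^i\in\{y^i_1,y^i_2,\ldots\}$). Let the sample sizes $n^i=n^i(n)$ satisfy $\underline C\le n^i/n\le\overline C$ for all $i$ and $n\ge 1$, for some constants $0<\underline C,\overline C<\infty$. Suppose that for each $i$ one of the following two cases occurs.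 1. (Moment and support constraints.) $\hat{\mathcal U}^i$ is the set of probability distributions $P^i$ concentrated on $\{y_1^i,\ldots,y_{n^i}^i\}$ with $E_{P^i}[f_l^i(X^i)]\le\mu_l^i$ for $l=1,\ldots,s^i$, where the $f^i_l:\mathcal X^i\to\mathbb R$ are measurable. Moreover $P_0^i$ is absolutely continuous with respect to $Q^i$, $L^i=dP_0^i/dQ^i$ is $Q^i$-essentially bounded, and $E_{P_0^i}[f_l^i(X^i)]<\mu_l^i$ and $E_{P_0^i}[f_l^i(X^i)^2]<\infty$ for all $l$. 2. ($\phi$-divergence ball.) Here $Q^i=P_b^i$ is a baseline distribution, and $\hat{\mathcal U}^i=\{P^i: d_\phi(P^i,\hat P_b^i)\le\eta^i\}$, where $\hat P_b^i$ is the empirical distribution of $y_1^i,\ldots,y_{n^i}^i$ and $d_\phi(P,B)=\int\phi(dP/dB)\,dB$ if $P\ll B$, $d_\phi(P,B)=\infty$ otherwise. The function $\phi=\phi^i:[0,\infty)\to(-\infty,\infty]$ is convex with $\phi(1)=0$, and it is finite and has a finite derivative at every $x>0$. Moreover $P_0^i$ is absolutely continuous with respect to $P_b^i$, $L^i=dP_0^i/dP_b^i$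 is $P_b^i$-essentially bounded, $d_\phi(P_0^i,P_b^i)<\eta^i$ and $E_{P_0^i}[\phi(L^i)^2]<\infty$. Let $$\hat Z_*=\inf_{P^i\in\hat{\mathcal U}^i,\,i=1,\ldots,m}Z(P^1,\ldots,P^m),\qquad \hat Z^*=\sup_{P^i\in\hat{\mathcal U}^i,\,i=1,\ldots,m}Z(P^1,\ldots,P^m)$$ (with $\inf\emptyset=+\infty$ and $\sup\emptyset=-\infty$). Then $$\hat Z_*\le Z_0+O_p\!\left(\frac1{\sqrt n}\right)\le\hat Z^*\qquad(n\to\infty),$$ that is, there are random variables $R_n$ with $R_n=O_p(1/\sqrt n)$ such that, almost surely, $\hat Z_*\le Z_0+R_n\le\hat Z^*$ for all sufficiently large $n$. -/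

import Mathlib

open MeasureTheory ProbabilityTheory Filter Topology
open scoped ENNReal

noncomputable section

namespace WorstCase

/-- `n⁻¹ ∑_{j < n} δ_{y j}`, the empirical distribution of `y 0, …, y (n - 1)`. -/
def empirical {X : Type*} [MeasurableSpace X] (n : ℕ) (y : ℕ → X) : Measure X :=
  (n : ℝ≥0∞)⁻¹ • ∑ j ∈ Finset.range n, Measure.dirac (y j)

/-- A divergence function `φ : [0, ∞) → (-∞, ∞]` (only the values at `x ≥ 0` matter): convex, in the
sense that its epigraph is convex, with `φ 1 = 0`, and finite with a finite derivative at every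
`x > 0`. The value `φ 0 = ⊤` is allowed, as for the Burg entropy `x - 1 - log x`; the value
`φ 0 = ⊥` is excluded by convexity. -/
structure IsDivergenceFunction (φ : ℝ → EReal) : Prop where
  convex : Convex ℝ {p : ℝ × ℝ | 0 ≤ p.1 ∧ φ p.1 ≤ (p.2 : EReal)}
  map_one : φ 1 = 0
  finite : ∀ x : ℝ, 0 < x → φ x ≠ ⊤ ∧ φ x ≠ ⊥
  differentiable : ∀ x : ℝ, 0 < x → DifferentiableAt ℝ (fun z => (φ z).toReal) x

open Classical in
/-- The `φ`-divergence `d_φ(P, B) = ∫ φ (dP/dB) dB`, which is `∞` unless `P ≪ B`. For finite `B` and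
convex `φ` the negative part of the integrand is integrable, so the integral is `∞` whenever the
integrand is not (almost surely finite and) integrable. -/
def phiDiv {X : Type*} [MeasurableSpace X] (φ : ℝ → EReal) (P B : Measure X) : EReal :=
  if P ≪ B ∧ (∀ᵐ x ∂B, φ (P.rnDeriv B x).toReal ≠ ⊤) ∧
      Integrable (fun x => (φ (P.rnDeriv B x).toReal).toReal) B
  then ((∫ x, (φ (P.rnDeriv B x).toReal).toReal ∂B : ℝ) : EReal)
  else ⊤

/-- The two kinds of constraints that can be put on an input model with values in `X`. -/
inductive ModelConstraint (X : Type*) where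
  /-- Moment and support constraints `E_P[f l] ≤ b l`, `l = 1, …, s`. -/
  | moment (s : ℕ) (f : Fin s → X → ℝ) (b : Fin s → ℝ) : ModelConstraint X
  /-- A `φ`-divergence ball of radius `η` around a baseline. -/
  | divergence (φ : ℝ → EReal) (η : ℝ) : ModelConstraint X

/-- The sampled uncertainty set built from the observations `y 0, …, y (n - 1)`:
* moment case: probability distributions carried by `{y 0, …, y (n - 1)}` that satisfy the moment
  constraints;
* divergence case: probability distributions in the divergence ball around the empirical
  distribution of `y 0, …, y (n - 1)`. -/
def sampledSet {X : Type*} [MeasurableSpace X] :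
    ModelConstraint X → (n : ℕ) → (y : ℕ → X) → Set (Measure X)
  | .moment _ f b, n, y =>
      {P | IsProbabilityMeasure P ∧ P {x | ∃ j < n, x = y j}ᶜ = 0 ∧ ∀ l, ∫ x, f l x ∂P ≤ b l}
  | .divergence φ η, n, y =>
      {P | IsProbabilityMeasure P ∧ phiDiv φ P (empirical n y) ≤ (η : EReal)}

/-- The assumptions on the true distribution `P₀` of an input model and on the distribution `Q` that
the observations are drawn from (in the divergence case `Q` is the baseline). -/
def Regular {X : Type*} [MeasurableSpace X] (P₀ Q : Measure X) : ModelConstraint X → Prop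
  | .moment _ f b =>
      P₀ ≪ Q ∧ essSup (P₀.rnDeriv Q) Q < ⊤ ∧
        ∀ l, Measurable (f l) ∧ Integrable (fun x => f l x ^ 2) P₀ ∧ ∫ x, f l x ∂P₀ < b l
  | .divergence φ η =>
      IsDivergenceFunction φ ∧ P₀ ≪ Q ∧ essSup (P₀.rnDeriv Q) Q < ⊤ ∧
        phiDiv φ P₀ Q < (η : EReal) ∧
        Integrable (fun x => (φ (P₀.rnDeriv Q x).toReal).toReal ^ 2) P₀

section Performance

variable {m : ℕ} {X : Fin m → Type*} [∀ i, MeasurableSpace (X i)] {T : Fin m → ℕ}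

/-- The performance measure `Z(P¹, …, Pᵐ) = E[h(𝐗¹, …, 𝐗ᵐ)]`, where `𝐗ⁱ` consists of `T i` i.i.d.
draws from `Pⁱ`, independently over `i`. -/
def perf (h : (∀ i, Fin (T i) → X i) → ℝ) (P : ∀ i, Measure (X i)) : ℝ :=
  ∫ x, h x ∂(Measure.pi fun i => Measure.pi fun _ : Fin (T i) => P i)

/-- The minimum of the performance measure over `∏ᵢ U i`, as an extended real (`⊤` if some `U i` is
empty). -/
def worstMin (h : (∀ i, Fin (T i) → X i) → ℝ) (U : ∀ i, Set (Measure (X i))) : EReal :=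
  ⨅ P ∈ {P : ∀ i, Measure (X i) | ∀ i, P i ∈ U i}, (perf h P : EReal)

/-- The maximum of the performance measure over `∏ᵢ U i`, as an extended real (`⊥` if some `U i` is
empty). -/
def worstMax (h : (∀ i, Fin (T i) → X i) → ℝ) (U : ∀ i, Set (Measure (X i))) : EReal :=
  ⨆ P ∈ {P : ∀ i, Measure (X i) | ∀ i, P i ∈ U i}, (perf h P : EReal)

end Performance

/-- `R n = O_p(a n)` as `n → ∞`. -/
def IsBigOInProb {Ω : Type*} [MeasurableSpace Ω] (μ : Measure Ω) (R : ℕ → Ω → ℝ) (a : ℕ → ℝ) :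
    Prop :=
  ∀ ε : ℝ, 0 < ε → ∃ M : ℝ, ∀ᶠ n in atTop, μ {ω | M * a n < |R n ω|} ≤ ENNReal.ofReal ε

end WorstCase

end

/-!
For each `i` let `ℓ` be a bounded version of the density `dP₀/dQ`. Reweighting the observations by
`ℓ` turns their empirical distribution into an approximation of `P₀`; its mass, the sample mean of
`ℓ`, is close to one but not equal to one. The weight `tilt` corrects the mass by adding to `ℓ` a
small multiple of the indicator function of `{ℓ ≥ 1 / 2}`, and `tilted` is the resulting
distribution. Both inequalities hold with `R n = Z(tilted) - Z₀`, for two reasons.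

* *Feasibility* (`ae_eventually_tilted_mem`). Almost surely, `tilted` is eventually in the sampled
  uncertainty set. For moment constraints this is the strong law of large numbers and the strict
  inequality `E_{P₀}[f l] < b l`. For a divergence ball, the density of `tilted` with respect to the
  empirical distribution is `tilt`. It agrees with `ℓ` where `ℓ < 1 / 2`, and elsewhere both lie in
  a compact subset of `(0, ∞)`, where `φ` is uniformly continuous. So the divergence exceeds the
  sample mean of `φ(ℓ)` by at most an arbitrarily small amount, and this sample mean tends to
  `d_φ(P₀, Q) < η`. Normalizing by a factor instead would change `ℓ` near `0`, where `φ` can vary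
  arbitrarily fast.
* *Rate* (`integral_tilted_vStat_sub_sq_le`). `Z(tilted)` is a V-statistic. With `ℓ` in place of
  `tilt` its kernel has mean `Z₀`, and expanding the square of the error into covariances gives a
  mean square error `O(1 / n)`, since kernel values with pairwise distinct indices are uncorrelated
  (`integral_vStat_sub_sq_le`). The replacement of `ℓ` by `tilt` costs `O(∑ |sampleMean ℓ - 1|)`,
  again of mean square `O(1 / n)`. Chebyshev's inequality turns this into `O_p(1 / √n)`.

The cost function is bounded only at arguments made up of observations, so it is truncated first
(`truncCost`); this changes neither `Z₀` nor, almost surely, `Z(tilted)`.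
-/

namespace WorstCase

/-! ### Products of measures with density -/

section Product

variable {S : Type*} [Fintype S] {X : S → Type*} [∀ s, MeasurableSpace (X s)]

theorem pi_withDensity (Q : ∀ s, Measure (X s)) [∀ s, IsProbabilityMeasure (Q s)]
    {f : ∀ s, X s → ℝ≥0∞} (hf : ∀ s, Measurable (f s))
    [∀ s, SigmaFinite ((Q s).withDensity (f s))] :
    Measure.pi (fun s => (Q s).withDensity (f s)) =
      (Measure.pi Q).withDensity fun x => ∏ s, f s (x s) := by
  refine Measure.pi_eq fun A hA => ?_
  rw [withDensity_apply _ (MeasurableSet.univ_pi hA),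
    ← lintegral_indicator (MeasurableSet.univ_pi hA)]
  have hind : ∀ s, Measurable ((A s).indicator (f s)) := fun s => (hf s).indicator (hA s)
  have h1 : ∀ x : ∀ s, X s, (Set.univ.pi A).indicator (fun x => ∏ s, f s (x s)) x =
      ∏ s, (A s).indicator (f s) (x s) := by
    intro x
    by_cases hx : x ∈ Set.univ.pi A
    · rw [Set.indicator_of_mem hx]
      exact Finset.prod_congr rfl fun s _ => (Set.indicator_of_mem (hx s trivial) _).symm
    · rw [Set.indicator_of_notMem hx]
      obtain ⟨s, hs⟩ : ∃ s, x s ∉ A s := by simpa using hx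
      exact (Finset.prod_eq_zero (Finset.mem_univ s) (Set.indicator_of_notMem hs _)).symm
  simp_rw [h1]
  rw [lintegral_prod_eq_prod_lintegral_of_indepFun Finset.univ
    (fun s (x : ∀ s, X s) => (A s).indicator (f s) (x s))
    (iIndepFun_pi (X := fun s => (A s).indicator (f s)) fun s => (hind s).aemeasurable)
    fun s => (hind s).comp (measurable_pi_apply s)]
  refine Finset.prod_congr rfl fun s _ => ?_
  rw [withDensity_apply _ (hA s), ← lintegral_indicator (hA s),
    ← (measurePreserving_eval Q s).lintegral_comp (hind s)]

/-- Change of measure for a product of reweighted distributions. It is used both for the product of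
the `P₀ i` relative to that of the `Q i`, and for products of reweighted empirical distributions. -/
theorem integral_pi_withDensity (Q : ∀ s, Measure (X s)) [∀ s, IsProbabilityMeasure (Q s)]
    {w : ∀ s, X s → ℝ} (hw : ∀ s, Measurable (w s)) (hw0 : ∀ s x, 0 ≤ w s x)
    (g : (∀ s, X s) → ℝ) :
    ∫ x, g x ∂(Measure.pi fun s => (Q s).withDensity fun x => ENNReal.ofReal (w s x)) =
      ∫ x, (∏ s, w s (x s)) * g x ∂(Measure.pi Q) := by
  rw [pi_withDensity Q fun s => (hw s).ennreal_ofReal,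
    integral_withDensity_eq_integral_toReal_smul]
  · refine integral_congr_ae (Eventually.of_forall fun x => ?_)
    simp only [ENNReal.toReal_prod, ENNReal.toReal_ofReal (hw0 _ _), smul_eq_mul]
  · exact Finset.measurable_prod _ fun s _ => (hw s).ennreal_ofReal.comp (measurable_pi_apply s)
  · exact Eventually.of_forall fun x => ENNReal.prod_lt_top fun s _ => ENNReal.ofReal_lt_top

end Product

/-! ### Empirical distributions -/

section Empirical

variable {X : Type*}

/-- The average of `f` over the first `n` terms of the sequence `z`. -/
noncomputable def sampleMean (n : ℕ) (f : X → ℝ) (z : ℕ → X) : ℝ :=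
  (∑ j ∈ Finset.range n, f (z j)) / n

variable [MeasurableSpace X]

theorem empirical_eq_map {n : ℕ} (z : ℕ → X) :
    empirical n z =
      ((n : ℝ≥0∞)⁻¹ • (Measure.count : Measure (Fin n))).map fun k : Fin n => z k := by
  ext A hA
  rw [Measure.map_apply (measurable_of_finite _) hA]
  simp only [empirical, Measure.smul_apply, Measure.finsetSum_apply, smul_eq_mul]
  congr 1
  rw [Measure.count,
    Measure.sum_apply _ (measurable_of_finite (fun k : Fin n => z k) hA), tsum_fintype,
    Finset.sum_range]
  refine Finset.sum_congr rfl fun k _ => ?_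
  rw [Measure.dirac_apply' _ hA,
    Measure.dirac_apply' _ (measurable_of_finite (fun k : Fin n => z k) hA)]
  rfl

instance isProbabilityMeasure_empirical {n : ℕ} [NeZero n] (z : ℕ → X) :
    IsProbabilityMeasure (empirical n z) := by
  constructor
  simp only [empirical, Measure.smul_apply, Measure.finsetSum_apply, smul_eq_mul, measure_univ,
    Finset.sum_const, Finset.card_range, nsmul_eq_mul, mul_one]
  exact ENNReal.inv_mul_cancel (by simpa using NeZero.ne n) (by simp)

variable [MeasurableSingletonClass X]

theorem integrable_empirical {n : ℕ} (hn : n ≠ 0) (f : X → ℝ) (z : ℕ → X) :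
    Integrable f (empirical n z) := by
  refine Integrable.smul_measure ?_ (by simpa using hn)
  exact integrable_finsetSum_measure.2 fun j _ => integrable_dirac (by simp)

theorem integral_empirical (n : ℕ) (f : X → ℝ) (z : ℕ → X) :
    ∫ x, f x ∂(empirical n z) = sampleMean n f z := by
  rw [empirical, integral_smul_measure,
    integral_finsetSum_measure fun j _ => integrable_dirac (by simp)]
  simp [sampleMean, div_eq_inv_mul]

theorem ae_empirical_iff {n : ℕ} {p : X → Prop} (z : ℕ → X) :
    (∀ᵐ x ∂(empirical n z), p x) ↔ ∀ j < n, p (z j) := by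
  rw [empirical, Measure.ae_ennreal_smul_measure_eq (by simp), ae_finsetSum_measure_iff]
  simp [ae_dirac_eq]

end Empirical

/-! ### V-statistics -/

section VStatistic

variable {S : Type*} [Fintype S] [DecidableEq S] {X : S → Type*}

/-- The V-statistic with kernel `g`: the average of `g` over all choices, for every `s`, of one of
the first `N s` terms of the sequence `z s`. -/
noncomputable def vStat (N : S → ℕ) (z : ∀ s, ℕ → X s) (g : (∀ s, X s) → ℝ) : ℝ :=
  (∏ s, (N s : ℝ))⁻¹ * ∑ J : ∀ s, Fin (N s), g fun s => z s (J s)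

theorem vStat_prod (N : S → ℕ) (z : ∀ s, ℕ → X s)
    (f : ∀ s, X s → ℝ) :
    vStat N z (fun x => ∏ s, f s (x s)) = ∏ s, sampleMean (N s) (f s) (z s) := by
  simp only [vStat, sampleMean, Finset.prod_div_distrib]
  rw [div_eq_inv_mul]
  congr 1
  simp only [Finset.sum_range]
  rw [Finset.prod_univ_sum, Fintype.piFinset_univ]

/-- The product of empirical distributions is the law of `fun s => z s (J s)` for a uniformly random
choice of indices `J`. -/
theorem integral_pi_empirical [∀ s, MeasurableSpace (X s)]
    (N : S → ℕ) (hN : ∀ s, N s ≠ 0) (z : ∀ s, ℕ → X s) {g : (∀ s, X s) → ℝ} (hg : Measurable g) :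
    ∫ x, g x ∂(Measure.pi fun s => empirical (N s) (z s)) = vStat N z g := by
  have : ∀ s, NeZero (N s) := fun s => ⟨hN s⟩
  have hfin : ∀ s, IsFiniteMeasure (((N s : ℝ≥0∞)⁻¹ • Measure.count : Measure (Fin (N s)))) :=
    fun s => Measure.smul_finite _ (by simpa using hN s)
  have hmap : Measure.pi (fun s => empirical (N s) (z s)) =
      (Measure.pi fun s => ((N s : ℝ≥0∞)⁻¹ • Measure.count : Measure (Fin (N s)))).map
        fun J s => z s (J s) := by
    simp only [empirical_eq_map]
    exact (Measure.pi_map_pi fun s =>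
      (measurable_of_finite fun k : Fin (N s) => z s k).aemeasurable).symm
  rw [hmap, integral_map (measurable_of_finite _).aemeasurable hg.aestronglyMeasurable,
    integral_fintype .of_finite, vStat, Finset.mul_sum]
  refine Finset.sum_congr rfl fun J _ => ?_
  rw [measureReal_def, Measure.pi_singleton]
  simp [ENNReal.toReal_prod, Finset.prod_inv_distrib]

theorem abs_prod_sub_prod_le {ι : Type*} (s : Finset ι) (u w : ι → ℝ) :
    |∏ i ∈ s, w i - ∏ i ∈ s, u i| ≤ ∏ i ∈ s, (|u i| + |w i - u i|) - ∏ i ∈ s, |u i| := by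
  classical
  induction s using Finset.induction_on with
  | empty => simp
  | insert a s ha ih =>
    rw [Finset.prod_insert ha, Finset.prod_insert ha, Finset.prod_insert ha, Finset.prod_insert ha]
    have h1 : |w a| ≤ |u a| + |w a - u a| := by
      have := abs_add_le (u a) (w a - u a); simpa using this
    have h2 : |∏ i ∈ s, u i| = ∏ i ∈ s, |u i| := Finset.abs_prod s u
    calc |w a * ∏ i ∈ s, w i - u a * ∏ i ∈ s, u i|
        = |w a * (∏ i ∈ s, w i - ∏ i ∈ s, u i) + (w a - u a) * ∏ i ∈ s, u i| := by ring_nf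
      _ ≤ |w a| * |∏ i ∈ s, w i - ∏ i ∈ s, u i| + |w a - u a| * ∏ i ∈ s, |u i| := by
          rw [← h2, ← abs_mul, ← abs_mul]; exact abs_add_le _ _
      _ ≤ (|u a| + |w a - u a|) * (∏ i ∈ s, (|u i| + |w i - u i|) - ∏ i ∈ s, |u i|) +
            |w a - u a| * ∏ i ∈ s, |u i| := by gcongr
      _ = _ := by ring

theorem prod_add_sub_prod_le {ι : Type*} (s : Finset ι) {b d : ι → ℝ} {K : ℝ} (hK : 1 ≤ K)
    (hb : ∀ i, 0 ≤ b i) (hd : ∀ i, 0 ≤ d i) (hbd : ∀ i, b i + d i ≤ K) :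
    ∏ i ∈ s, (b i + d i) - ∏ i ∈ s, b i ≤ K ^ s.card * ∑ i ∈ s, d i := by
  classical
  induction s using Finset.induction_on with
  | empty => simp
  | insert a s ha ih =>
    rw [Finset.prod_insert ha, Finset.prod_insert ha, Finset.sum_insert ha,
      Finset.card_insert_of_notMem ha]
    have h1 : ∏ i ∈ s, b i ≤ K ^ s.card :=
      by
      rw [← Finset.prod_const]
      exact Finset.prod_le_prod (fun i _ => hb i) fun i _ => by linarith [hbd i, hd i]
    have h2 : 0 ≤ ∑ i ∈ s, d i := Finset.sum_nonneg fun i _ => hd i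
    have h3 : 0 ≤ K ^ s.card := by positivity
    calc (b a + d a) * ∏ i ∈ s, (b i + d i) - b a * ∏ i ∈ s, b i
        = (b a + d a) * (∏ i ∈ s, (b i + d i) - ∏ i ∈ s, b i) + d a * ∏ i ∈ s, b i := by ring
      _ ≤ (b a + d a) * (K ^ s.card * ∑ i ∈ s, d i) + d a * K ^ s.card := by
          gcongr
          · exact add_nonneg (hb a) (hd a)
          · exact hd a
      _ ≤ K * (K ^ s.card * ∑ i ∈ s, d i) + (d a * K ^ s.card) * K := by
          refine add_le_add ?_ ?_
          · exact mul_le_mul_of_nonneg_right (hbd a) (mul_nonneg h3 h2)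
          · exact le_mul_of_one_le_right (mul_nonneg (hd a) h3) hK
      _ = _ := by ring

/-- The effect on a V-statistic of replacing the weights `u` by the weights `w`. The bound factorizes
over `S`, since a V-statistic with a product kernel is a product of sample means. -/
theorem abs_vStat_prod_mul_sub_le (N : S → ℕ) (z : ∀ s, ℕ → X s)
    (u w : ∀ s, X s → ℝ) {g : (∀ s, X s) → ℝ} {M : ℝ} (hM : ∀ x, |g x| ≤ M) :
    |vStat N z (fun x => (∏ s, w s (x s)) * g x) - vStat N z (fun x => (∏ s, u s (x s)) * g x)| ≤
      M * (∏ s, (sampleMean (N s) (fun x => |u s x|) (z s) +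
          sampleMean (N s) (fun x => |w s x - u s x|) (z s)) -
        ∏ s, sampleMean (N s) (fun x => |u s x|) (z s)) := by
  have hadd : ∀ s, sampleMean (N s) (fun x => |u s x|) (z s) +
      sampleMean (N s) (fun x => |w s x - u s x|) (z s) =
      sampleMean (N s) (fun x => |u s x| + |w s x - u s x|) (z s) := fun s => by
    simp [sampleMean, Finset.sum_add_distrib, add_div]
  simp only [hadd]
  rw [← vStat_prod N z fun s x => |u s x| + |w s x - u s x|, ← vStat_prod N z fun s x => |u s x|]
  have hpos : (0 : ℝ) ≤ (∏ s, (N s : ℝ))⁻¹ := by positivity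
  simp only [vStat]
  rw [← mul_sub, ← mul_sub, ← Finset.sum_sub_distrib, ← Finset.sum_sub_distrib, abs_mul,
    abs_of_nonneg hpos, mul_left_comm]
  refine mul_le_mul_of_nonneg_left ?_ hpos
  rw [Finset.mul_sum]
  refine (Finset.abs_sum_le_sum_abs _ _).trans (Finset.sum_le_sum fun J _ => ?_)
  rw [← sub_mul, abs_mul, mul_comm]
  exact mul_le_mul (hM _) (abs_prod_sub_prod_le _ _ _) (abs_nonneg _)
    ((abs_nonneg _).trans (hM fun s => z s (J s)))

end VStatistic

/-! ### The performance measure as one integral -/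

section Performance

variable {m : ℕ} {X : Fin m → Type*} [∀ i, MeasurableSpace (X i)] {T : Fin m → ℕ}

theorem perf_eq_integral_sigma (h : (∀ i, Fin (T i) → X i) → ℝ) (P : ∀ i, Measure (X i))
    [∀ i, IsProbabilityMeasure (P i)] :
    perf h P = ∫ x, h (Sigma.curry x)
      ∂(Measure.pi fun s : (Σ i, Fin (T i)) => P s.1) := by
  have := Measure.infinitePi_map_piCurry (X := fun i (_ : Fin (T i)) => X i)
    (fun i (_ : Fin (T i)) => P i)
  simp only [Measure.infinitePi_eq_pi] at this
  rw [perf, ← this, integral_map_equiv]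
  rfl

end Performance

/-! ### Counting coincidences of indices -/

section Count

variable {S : Type*} [Fintype S] [DecidableEq S]

/-- If `F J` does not depend on the coordinate `J s`, then `J s = F J` for at most one value of `J s`
when the other coordinates are given. -/
theorem card_filter_apply_eq_mul_le (N : S → ℕ) (s : S) (F : (∀ s, Fin (N s)) → ℕ)
    (hF : ∀ J k, F (Function.update J s k) = F J) :
    (Finset.univ.filter fun J : ∀ s, Fin (N s) => (J s : ℕ) = F J).card * N s ≤
      ∏ s, N s := by
  have hcard : (∏ s, N s) = (Finset.univ : Finset (∀ s, Fin (N s))).card := by simp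
  have hcard' : N s = (Finset.univ : Finset (Fin (N s))).card := by simp
  rw [hcard]
  refine (congrArg₂ (· * ·) rfl hcard').trans_le ?_
  rw [← Finset.card_product]
  refine Finset.card_le_card_of_injOn (fun p => Function.update p.1 s p.2) (fun _ _ => by simp) ?_
  rintro ⟨J, k⟩ hJ ⟨J', k'⟩ hJ' hEq
  have hJs : (J s : ℕ) = F J := by simpa using hJ
  have hJs' : (J' s : ℕ) = F J' := by simpa using hJ'
  have heq : Function.update J s k = Function.update J' s k' := hEq
  have hk : k = k' := by simpa using congrFun heq s
  refine Prod.ext (funext fun t => ?_) hk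
  by_cases ht : t = s
  · subst ht
    refine Fin.ext ?_
    rw [hJs, hJs', ← hF J k, heq, hF]
  · simpa [ht] using congrFun heq t

theorem sum_ite_apply_eq_le (N : S → ℕ) (s : S) (F : (∀ s, Fin (N s)) → ℕ)
    (hF : ∀ J k, F (Function.update J s k) = F J) {r : ℝ} (hr : 0 < r) (hN : r ≤ N s) :
    ∑ J : ∀ s, Fin (N s), (if (J s : ℕ) = F J then (1 : ℝ) else 0) ≤ (∏ s, (N s : ℝ)) / r := by
  rw [Finset.sum_boole, le_div_iff₀ hr]
  calc _ ≤ (((Finset.univ.filter fun J : ∀ s, Fin (N s) => (J s : ℕ) = F J).card : ℕ) : ℝ) * N s :=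
        mul_le_mul_of_nonneg_left hN (Nat.cast_nonneg _)
    _ ≤ _ := by exact_mod_cast card_filter_apply_eq_mul_le N s F hF

/-- A property `p` that holds for all pairs `(J, J')` without a coincidence among their
`2 |S|` entries fails for a fraction of at most `3 |S|² / r` of all pairs. -/
theorem sum_sum_not_injective_le (N : S → ℕ) {r : ℝ} (hr : 0 < r) (hN : ∀ s, r ≤ N s)
    (p : (∀ s, Fin (N s)) → (∀ s, Fin (N s)) → Prop) [∀ J J', Decidable (p J J')]
    (hp : ∀ J J' : ∀ s, Fin (N s), (∀ s t, s ≠ t → (J s : ℕ) ≠ J t) →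
      (∀ s t, s ≠ t → (J' s : ℕ) ≠ J' t) → (∀ s t, (J s : ℕ) ≠ J' t) → p J J') :
    ∑ J : ∀ s, Fin (N s), ∑ J' : ∀ s, Fin (N s), (if p J J' then (0 : ℝ) else 1) ≤
      3 * (Fintype.card S : ℝ) ^ 2 / r * (∏ s, (N s : ℝ)) ^ 2 := by
  set K : ℝ := ∏ s, (N s : ℝ) with hKdef
  have hK : (0 : ℝ) ≤ K := by positivity
  have hcard : ((Finset.univ : Finset (∀ s, Fin (N s))).card : ℝ) = K := by simp [hKdef]
  -- `e` marks coincidences between `J` and `J'`, and `d` coincidences within `J`.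
  let e : (∀ s, Fin (N s)) → (∀ s, Fin (N s)) → S → S → ℝ := fun J J' s t =>
    (if (J s : ℕ) = J' t then (1 : ℝ) else 0)
  let d : (∀ s, Fin (N s)) → S → S → ℝ := fun J s t =>
    if s ≠ t then (if (J s : ℕ) = J t then (1 : ℝ) else 0) else 0
  have he0 : ∀ J J' s t, 0 ≤ e J J' s t := fun J J' s t => by
    simp only [e]; split_ifs <;> norm_num
  have hd0 : ∀ J s t, 0 ≤ d J s t := fun J s t => by
    simp only [d]; split_ifs <;> norm_num
  have hdle : ∀ J : ∀ s, Fin (N s), ∀ s t, d J s t ≤ ∑ s, ∑ t, d J s t := fun J s t =>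
    (Finset.single_le_sum (f := d J s) (fun t _ => hd0 J s t) (Finset.mem_univ t)).trans
      (Finset.single_le_sum (f := fun s => ∑ t, d J s t)
        (fun s _ => Finset.sum_nonneg fun t _ => hd0 J s t) (Finset.mem_univ s))
  have hele : ∀ J J' : ∀ s, Fin (N s), ∀ s t, e J J' s t ≤ ∑ s, ∑ t, e J J' s t := fun J J' s t =>
    (Finset.single_le_sum (f := e J J' s) (fun t _ => he0 J J' s t) (Finset.mem_univ t)).trans
      (Finset.single_le_sum (f := fun s => ∑ t, e J J' s t)
        (fun s _ => Finset.sum_nonneg fun t _ => he0 J J' s t) (Finset.mem_univ s))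
  have hdS : ∀ J : ∀ s, Fin (N s), 0 ≤ ∑ s, ∑ t, d J s t := fun J =>
    Finset.sum_nonneg fun s _ => Finset.sum_nonneg fun t _ => hd0 J s t
  have heS : ∀ J J' : ∀ s, Fin (N s), 0 ≤ ∑ s, ∑ t, e J J' s t := fun J J' =>
    Finset.sum_nonneg fun s _ => Finset.sum_nonneg fun t _ => he0 J J' s t
  have hdone : ∀ J : ∀ s, Fin (N s), (¬ ∀ s t, s ≠ t → (J s : ℕ) ≠ J t) →
      1 ≤ ∑ s, ∑ t, d J s t := by
    intro J hJ
    push Not at hJ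
    obtain ⟨s, t, hst, h⟩ := hJ
    refine le_trans (le_of_eq ?_) (hdle J s t)
    simp [d, hst, h]
  have key : ∀ J J' : ∀ s, Fin (N s), (if p J J' then (0 : ℝ) else 1) ≤
      (∑ s, ∑ t, d J s t) + (∑ s, ∑ t, d J' s t) + ∑ s, ∑ t, e J J' s t := by
    intro J J'
    split_ifs with h
    · have := hdS J; have := hdS J'; have := heS J J'; linarith
    · by_cases h1 : ∀ s t, s ≠ t → (J s : ℕ) ≠ J t
      · by_cases h2 : ∀ s t, s ≠ t → (J' s : ℕ) ≠ J' t
        · have h3 : ¬ ∀ s t, (J s : ℕ) ≠ J' t := fun h3 => h (hp J J' h1 h2 h3)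
          push Not at h3
          obtain ⟨s, t, hst⟩ := h3
          have h4 : 1 ≤ ∑ s, ∑ t, e J J' s t := by
            refine le_trans (le_of_eq ?_) (hele J J' s t)
            simp [e, hst]
          have := hdS J; have := hdS J'; linarith
        · have := hdone J' h2; have := hdS J; have := heS J J'; linarith
      · have := hdone J h1; have := hdS J'; have := heS J J'; linarith
  have hdsum : ∀ s t, ∑ J : ∀ s, Fin (N s), d J s t ≤ K / r := by
    intro s t
    by_cases hst : s = t
    · simp only [d, hst, ne_eq, not_true_eq_false, if_false, Finset.sum_const_zero]
      positivity
    · simp only [d, ne_eq, hst, not_false_eq_true, if_true]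
      exact sum_ite_apply_eq_le N s (fun J => J t)
        (fun J k => by simp [Function.update_of_ne (Ne.symm hst)]) hr (hN s)
  have hesum : ∀ (J' : ∀ s, Fin (N s)) s t, ∑ J : ∀ s, Fin (N s), e J J' s t ≤ K / r :=
    fun J' s t => sum_ite_apply_eq_le N s (fun _ => J' t) (fun J k => rfl) hr (hN s)
  have hD : ∑ J : ∀ s, Fin (N s), ∑ s, ∑ t, d J s t ≤ (Fintype.card S : ℝ) ^ 2 * (K / r) := by
    rw [Finset.sum_comm]
    calc _ = ∑ s, ∑ t, ∑ J : ∀ s, Fin (N s), d J s t :=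
          Finset.sum_congr rfl fun s _ => Finset.sum_comm
      _ ≤ ∑ s : S, ∑ t : S, K / r :=
          Finset.sum_le_sum fun s _ => Finset.sum_le_sum fun t _ => hdsum s t
      _ = _ := by simp; ring
  have hE : ∀ J' : ∀ s, Fin (N s), ∑ J : ∀ s, Fin (N s), ∑ s, ∑ t, e J J' s t ≤
      (Fintype.card S : ℝ) ^ 2 * (K / r) := by
    intro J'
    rw [Finset.sum_comm]
    calc _ = ∑ s, ∑ t, ∑ J : ∀ s, Fin (N s), e J J' s t :=
          Finset.sum_congr rfl fun s _ => Finset.sum_comm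
      _ ≤ ∑ s : S, ∑ t : S, K / r :=
          Finset.sum_le_sum fun s _ => Finset.sum_le_sum fun t _ => hesum J' s t
      _ = _ := by simp; ring
  calc _ ≤ ∑ J : ∀ s, Fin (N s), ∑ J' : ∀ s, Fin (N s), ((∑ s, ∑ t, d J s t) +
        (∑ s, ∑ t, d J' s t) + ∑ s, ∑ t, e J J' s t) :=
        Finset.sum_le_sum fun J _ => Finset.sum_le_sum fun J' _ => key J J'
    _ = K * (∑ J : ∀ s, Fin (N s), ∑ s, ∑ t, d J s t) +
        K * (∑ J : ∀ s, Fin (N s), ∑ s, ∑ t, d J s t) +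
        ∑ J' : ∀ s, Fin (N s), ∑ J : ∀ s, Fin (N s), ∑ s, ∑ t, e J J' s t := by
        simp only [Finset.sum_add_distrib]
        congr 1
        · rw [Finset.sum_const, nsmul_eq_mul, hcard]
          congr 1
          simp only [Finset.sum_const, nsmul_eq_mul, hcard, Finset.mul_sum]
        · exact Finset.sum_comm
    _ ≤ K * ((Fintype.card S : ℝ) ^ 2 * (K / r)) + K * ((Fintype.card S : ℝ) ^ 2 * (K / r)) +
        ∑ J' : ∀ s, Fin (N s), (Fintype.card S : ℝ) ^ 2 * (K / r) := by
        gcongr with J' _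
        exact hE J'
    _ = _ := by
        rw [Finset.sum_const, nsmul_eq_mul, hcard]; ring

end Count

/-! ### Mean square error and strong law for samples -/

section Sampling

variable {Ω I S : Type*} [MeasurableSpace Ω] {μ : Measure Ω}
  {X : I → Type*} [∀ i, MeasurableSpace (X i)] {Q : ∀ i, Measure (X i)}
  {y : ∀ i, ℕ → Ω → X i}

theorem map_sample_eq_pi [IsProbabilityMeasure μ] [Fintype S]
    (hy : ∀ i j, Measurable (y i j))
    (hlaw : ∀ i j, μ.map (y i j) = Q i)
    (hindep : iIndepFun (fun (p : I × ℕ) => y p.1 p.2) μ) (c : S → I) (J : S → ℕ)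
    (hJ : Function.Injective J) :
    μ.map (fun ω s => y (c s) (J s) ω) = Measure.pi fun s => Q (c s) := by
  have h := hindep.precomp (g := fun s => (c s, J s)) fun s t hst => hJ (Prod.ext_iff.1 hst).2
  rw [(iIndepFun_iff_map_fun_eq_pi_map fun s => (hy _ _).aemeasurable).1 h]
  simp only [hlaw]

theorem integral_sample_eq [IsProbabilityMeasure μ] [Fintype S]
    (hy : ∀ i j, Measurable (y i j))
    (hlaw : ∀ i j, μ.map (y i j) = Q i)
    (hindep : iIndepFun (fun (p : I × ℕ) => y p.1 p.2) μ) (c : S → I) (J : S → ℕ)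
    (hJ : Function.Injective J) {g : (∀ s, X (c s)) → ℝ} (hg : Measurable g) :
    ∫ ω, g (fun s => y (c s) (J s) ω) ∂μ = ∫ x, g x ∂(Measure.pi fun s => Q (c s)) := by
  rw [← map_sample_eq_pi hy hlaw hindep c J hJ,
    integral_map (measurable_pi_lambda _ fun s => hy _ _).aemeasurable hg.aestronglyMeasurable]

theorem indepFun_sample [Fintype S] (hy : ∀ i j, Measurable (y i j))
    (hindep : iIndepFun (fun (p : I × ℕ) => y p.1 p.2) μ) (c : S → I) (J J' : S → ℕ)
    (hJ : ∀ s t, J s ≠ J' t) {g g' : (∀ s, X (c s)) → ℝ} (hg : Measurable g)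
    (hg' : Measurable g') :
    IndepFun (fun ω => g fun s => y (c s) (J s) ω) (fun ω => g' fun s => y (c s) (J' s) ω) μ := by
  classical
  have hmem : ∀ (J : S → ℕ) (s : S), (c s, J s) ∈ Finset.univ.image fun s => (c s, J s) :=
    fun J s => Finset.mem_image_of_mem _ (Finset.mem_univ s)
  have hdisj : Disjoint (Finset.univ.image fun s => (c s, J s))
      (Finset.univ.image fun s => (c s, J' s)) := by
    rw [Finset.disjoint_left]
    intro p hp hp'
    obtain ⟨s, _, rfl⟩ := Finset.mem_image.1 hp
    obtain ⟨t, _, ht⟩ := Finset.mem_image.1 hp'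
    exact hJ s t (Prod.ext_iff.1 ht).2.symm
  have h := hindep.indepFun_finset _ _ hdisj fun p => hy p.1 p.2
  have hmeas : ∀ (J : S → ℕ), Measurable
      fun (z : ∀ p : (Finset.univ.image fun s => (c s, J s)), X p.1.1) (s : S) =>
        (z ⟨(c s, J s), hmem J s⟩ : X (c s)) :=
    fun J => measurable_pi_lambda _ fun s => measurable_pi_apply _
  exact h.comp (hg.comp (hmeas J)) (hg'.comp (hmeas J'))

/-- A V-statistic with bounded kernel is `L²`-close to the integral of its kernel, with rate
`1 / r` for the mean square when all sample sizes are at least `r`: the covariance of two kernel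
values vanishes unless two of the at most `2 |S|` indices involved agree, and this happens for
only a fraction `O(1 / r)` of the pairs of indices. -/
theorem integral_vStat_sub_sq_le [IsProbabilityMeasure μ] [Fintype S] [DecidableEq S]
    (hy : ∀ i j, Measurable (y i j))
    (hlaw : ∀ i j, μ.map (y i j) = Q i)
    (hindep : iIndepFun (fun (p : I × ℕ) => y p.1 p.2) μ) (c : S → I)
    {g : (∀ s, X (c s)) → ℝ} (hg : Measurable g) {C : ℝ} (hC : ∀ x, |g x| ≤ C)
    (N : S → ℕ) {r : ℝ} (hr : 0 < r) (hN : ∀ s, r ≤ N s) :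
    ∫ ω, (vStat N (fun s j => y (c s) j ω) g - ∫ x, g x ∂(Measure.pi fun s => Q (c s))) ^ 2 ∂μ ≤
      12 * C ^ 2 * (Fintype.card S : ℝ) ^ 2 / r := by
  classical
  rcases isEmpty_or_nonempty Ω with hΩ | ⟨⟨ω₀⟩⟩
  · simp only [integral_of_isEmpty]
    positivity
  have hC0 : 0 ≤ C := (abs_nonneg _).trans (hC fun s => y (c s) 0 ω₀)
  have hQ : ∀ i, IsProbabilityMeasure (Q i) := fun i => by
    rw [← hlaw i 0]; exact Measure.isProbabilityMeasure_map (hy i 0).aemeasurable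
  set Z := ∫ x, g x ∂(Measure.pi fun s => Q (c s)) with hZ
  have hZC : |Z| ≤ C := by
    have := norm_integral_le_of_norm_le_const (μ := Measure.pi fun s => Q (c s)) (f := g)
      (Eventually.of_forall hC)
    simpa using this
  set K : ℝ := ∏ s, (N s : ℝ) with hK
  have hKpos : 0 < K := Finset.prod_pos fun s _ => hr.trans_le (hN s)
  have hcard : ((Finset.univ : Finset (∀ s, Fin (N s))).card : ℝ) = K := by simp [hK]
  let D : (∀ s, Fin (N s)) → Ω → ℝ := fun J ω => g (fun s => y (c s) (J s) ω) - Z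
  have hDm : ∀ J, Measurable (D J) := fun J =>
    (hg.comp (measurable_pi_lambda _ fun s => hy _ _)).sub_const Z
  have hDb : ∀ J ω, |D J ω| ≤ 2 * C := fun J ω => by
    refine (abs_sub _ _).trans ?_
    linarith [hC fun s => y (c s) (J s) ω]
  have hDDb : ∀ J J' ω, |D J ω * D J' ω| ≤ 4 * C ^ 2 := fun J J' ω => by
    rw [abs_mul]
    calc _ ≤ (2 * C) * (2 * C) := mul_le_mul (hDb J ω) (hDb J' ω) (abs_nonneg _) (by positivity)
      _ = _ := by ring
  have hDD : ∀ J J', Integrable (fun ω => D J ω * D J' ω) μ := fun J J' =>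
    Integrable.of_bound ((hDm J).mul (hDm J')).aestronglyMeasurable (4 * C ^ 2)
      (Eventually.of_forall (hDDb J J'))
  have hexp : ∀ ω, (vStat N (fun s j => y (c s) j ω) g - Z) ^ 2 =
      (K⁻¹) ^ 2 * ∑ J, ∑ J', D J ω * D J' ω := fun ω => by
    have h1 : vStat N (fun s j => y (c s) j ω) g - Z = K⁻¹ * ∑ J, D J ω := by
      simp only [vStat, D, Finset.sum_sub_distrib, Finset.sum_const, nsmul_eq_mul, hcard, mul_sub]
      rw [← mul_assoc, inv_mul_cancel₀ hKpos.ne', one_mul]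
    rw [h1, mul_pow, pow_two (∑ J, D J ω), Finset.sum_mul_sum]
  simp only [hexp]
  rw [integral_const_mul,
    integral_finsetSum _ fun J _ => integrable_finsetSum _ fun J' _ => hDD J J']
  simp_rw [fun J => integral_finsetSum (μ := μ) Finset.univ
    (f := fun J' ω => D J ω * D J' ω) fun J' _ => hDD J J']
  -- It is enough to count the pairs of indices whose covariance does not vanish.
  let p : (∀ s, Fin (N s)) → (∀ s, Fin (N s)) → Prop := fun J J' => ∫ ω, D J ω * D J' ω ∂μ = 0
  have hbad : ∀ J J', ∫ ω, D J ω * D J' ω ∂μ ≤ 4 * C ^ 2 * (if p J J' then (0 : ℝ) else 1) := by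
    intro J J'
    split_ifs with h
    · rw [mul_zero]; exact h.le
    · have := norm_integral_le_of_norm_le_const (μ := μ) (f := fun ω => D J ω * D J' ω)
        (Eventually.of_forall (hDDb J J'))
      simpa using (le_abs_self _).trans this
  have hgood : ∀ J J' : ∀ s, Fin (N s), (∀ s t, s ≠ t → (J s : ℕ) ≠ J t) →
      (∀ s t, s ≠ t → (J' s : ℕ) ≠ J' t) → (∀ s t, (J s : ℕ) ≠ J' t) → p J J' := by
    intro J J' h1 h2 h3
    have hinj : Function.Injective fun s => (J s : ℕ) := fun s t hst => by
      by_contra hne; exact h1 s t hne hst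
    have hI := indepFun_sample hy hindep c (fun s => (J s : ℕ)) (fun s => (J' s : ℕ)) h3
      (hg.sub_const Z) (hg.sub_const Z)
    have hmean : ∫ ω, D J ω ∂μ = 0 := by
      have hint : Integrable g (Measure.pi fun s => Q (c s)) :=
        Integrable.of_bound hg.aestronglyMeasurable C (Eventually.of_forall hC)
      simp only [D]
      rw [integral_sample_eq hy hlaw hindep c (fun s => (J s : ℕ)) hinj (hg.sub_const Z),
        integral_sub hint (integrable_const _), ← hZ]
      simp
    have := hI.integral_fun_mul_eq_mul_integral (hDm J).aestronglyMeasurable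
      (hDm J').aestronglyMeasurable
    exact this.trans (by rw [show ∫ ω, (g (fun s => y (c s) (J s) ω) - Z) ∂μ = 0 from hmean,
      zero_mul])
  calc (K⁻¹) ^ 2 * ∑ J, ∑ J', ∫ ω, D J ω * D J' ω ∂μ
      ≤ (K⁻¹) ^ 2 * ∑ J, ∑ J', 4 * C ^ 2 * (if p J J' then (0 : ℝ) else 1) := by
        gcongr with J _ J' _
        exact hbad J J'
    _ = (K⁻¹) ^ 2 * (4 * C ^ 2 * ∑ J, ∑ J', (if p J J' then (0 : ℝ) else 1)) := by
        simp only [Finset.mul_sum]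
    _ ≤ (K⁻¹) ^ 2 * (4 * C ^ 2 * (3 * (Fintype.card S : ℝ) ^ 2 / r * K ^ 2)) := by
        gcongr
        exact sum_sum_not_injective_le N hr hN p hgood
    _ = _ := by field_simp; ring

theorem integral_sampleMean_sub_sq_le [IsProbabilityMeasure μ]
    (hy : ∀ i j, Measurable (y i j))
    (hlaw : ∀ i j, μ.map (y i j) = Q i)
    (hindep : iIndepFun (fun (p : I × ℕ) => y p.1 p.2) μ) (i : I)
    {f : X i → ℝ} (hf : Measurable f) {C : ℝ} (hC : ∀ x, |f x| ≤ C)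
    (n : ℕ) {r : ℝ} (hr : 0 < r) (hn : r ≤ n) :
    ∫ ω, (sampleMean n f (fun j => y i j ω) - ∫ x, f x ∂(Q i)) ^ 2 ∂μ ≤ 12 * C ^ 2 / r := by
  have hQ : ∀ i, IsProbabilityMeasure (Q i) := fun i => by
    rw [← hlaw i 0]; exact Measure.isProbabilityMeasure_map (hy i 0).aemeasurable
  have h := integral_vStat_sub_sq_le hy hlaw hindep (fun _ : Unit => i)
    (g := fun x => ∏ s, f (x s)) (by fun_prop) (C := C) (fun x => by simpa using hC (x ()))
    (fun _ => n) hr (fun _ => hn)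
  simp only [vStat_prod (fun _ : Unit => n) _ fun _ => f,
    integral_fintype_prod_eq_prod (μ := fun _ : Unit => Q i) fun _ => f] at h
  simpa using h

theorem ae_all_sample (hy : ∀ i j, Measurable (y i j)) (hlaw : ∀ i j, μ.map (y i j) = Q i) (i : I)
    {p : X i → Prop} (hp : ∀ᵐ x ∂(Q i), p x) : ∀ᵐ ω ∂μ, ∀ j, p (y i j ω) :=
  ae_all_iff.2 fun j => ae_of_ae_map (hy i j).aemeasurable (by rwa [hlaw i j])

/-- The strong law of large numbers, for a function of the observations. -/
theorem tendsto_sampleMean (hy : ∀ i j, Measurable (y i j))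
    (hlaw : ∀ i j, μ.map (y i j) = Q i)
    (hindep : iIndepFun (fun (p : I × ℕ) => y p.1 p.2) μ) (i : I)
    {f : X i → ℝ} (hf : Integrable f (Q i)) :
    ∀ᵐ ω ∂μ, Tendsto (fun n => sampleMean n f fun j => y i j ω) atTop (𝓝 (∫ x, f x ∂(Q i))) := by
  obtain ⟨f', hmeas, hae⟩ := hf.aestronglyMeasurable.aemeasurable
  have hmk := ae_all_sample hy hlaw i hae
  have hint : Integrable f' (Q i) := hf.congr hae
  have hslln := strong_law_ae_real (μ := μ) (fun j ω => f' (y i j ω))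
    (by
      rw [← hlaw i 0] at hint
      exact hint.comp_measurable (hy i 0))
    (fun j k hjk => (hindep.indepFun (i := (i, j)) (j := (i, k))
      fun h => hjk (Prod.ext_iff.1 h).2).comp hmeas hmeas)
    (fun j => IdentDistrib.comp ⟨(hy i j).aemeasurable, (hy i 0).aemeasurable, by
      rw [hlaw, hlaw]⟩ hmeas)
  have hmean : ∫ ω, f' (y i 0 ω) ∂μ = ∫ x, f x ∂(Q i) := by
    rw [integral_congr_ae hae, ← hlaw i 0,
      integral_map (hy i 0).aemeasurable hmeas.aestronglyMeasurable]
  rw [hmean] at hslln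
  filter_upwards [hslln, hmk] with ω h1 h2
  simpa only [sampleMean, h2] using h1

end Sampling

/-! ### Bounded likelihood ratios -/

section Density

variable {X : Type*}

/-- The indicator function of the set where the likelihood ratio `ℓ` is at least `1 / 2`. -/
noncomputable def bulk (ℓ : X → ℝ) : X → ℝ := {x | 1 / 2 ≤ ℓ x}.indicator 1

theorem bulk_of_le {ℓ : X → ℝ} {x : X} (h : 1 / 2 ≤ ℓ x) : bulk ℓ x = 1 :=
  Set.indicator_of_mem (s := {x | 1 / 2 ≤ ℓ x}) h _

theorem bulk_of_lt {ℓ : X → ℝ} {x : X} (h : ℓ x < 1 / 2) : bulk ℓ x = 0 :=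
  Set.indicator_of_notMem (s := {x | 1 / 2 ≤ ℓ x}) (not_le.2 h) _

theorem bulk_nonneg (ℓ : X → ℝ) (x : X) : 0 ≤ bulk ℓ x :=
  Set.indicator_nonneg (fun _ _ => zero_le_one) x

theorem bulk_le_one (ℓ : X → ℝ) (x : X) : bulk ℓ x ≤ 1 :=
  Set.indicator_le_self' (f := 1) (fun _ _ => zero_le_one) x

variable [MeasurableSpace X]

theorem measurable_bulk {ℓ : X → ℝ} (hℓ : Measurable ℓ) : Measurable (bulk ℓ) :=
  measurable_one.indicator (measurableSet_le measurable_const hℓ)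

/-- A version of the density `dP/dQ` that is bounded everywhere, and not only almost everywhere. -/
theorem exists_bounded_density {P Q : Measure X} [IsProbabilityMeasure P] [IsProbabilityMeasure Q]
    (hPQ : P ≪ Q) (hess : essSup (P.rnDeriv Q) Q < ⊤) :
    ∃ (ℓ : X → ℝ) (B : ℝ), Measurable ℓ ∧ (∀ x, 0 ≤ ℓ x) ∧ (∀ x, ℓ x ≤ B) ∧
      P = Q.withDensity (fun x => ENNReal.ofReal (ℓ x)) ∧
      ∀ᵐ x ∂Q, (P.rnDeriv Q x).toReal = ℓ x := by
  set B := (essSup (P.rnDeriv Q) Q).toReal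
  have hae : ∀ᵐ x ∂Q, (P.rnDeriv Q x).toReal = min (P.rnDeriv Q x).toReal B := by
    filter_upwards [ENNReal.ae_le_essSup (μ := Q) (P.rnDeriv Q)] with x hx
    exact (min_eq_left (ENNReal.toReal_mono hess.ne hx)).symm
  refine ⟨fun x => min (P.rnDeriv Q x).toReal B, B,
    (Measure.measurable_rnDeriv P Q).ennreal_toReal.min measurable_const,
    fun x => le_min ENNReal.toReal_nonneg ENNReal.toReal_nonneg, fun x => min_le_right _ _, ?_, hae⟩
  conv_lhs => rw [← Measure.withDensity_rnDeriv_eq P Q hPQ]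
  refine withDensity_congr_ae ?_
  filter_upwards [hae, Measure.rnDeriv_lt_top P Q] with x hx hx'
  rw [← hx, ENNReal.ofReal_toReal hx'.ne]

variable {P Q : Measure X}
  {ℓ : X → ℝ} {B : ℝ}

theorem integral_eq_integral_density_mul (hℓ : Measurable ℓ) (h0 : ∀ x, 0 ≤ ℓ x)
    (hP : P = Q.withDensity fun x => ENNReal.ofReal (ℓ x)) (f : X → ℝ) :
    ∫ x, f x ∂P = ∫ x, ℓ x * f x ∂Q := by
  rw [hP, integral_withDensity_eq_integral_toReal_smul hℓ.ennreal_ofReal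
    (Eventually.of_forall fun x => ENNReal.ofReal_lt_top)]
  simp [ENNReal.toReal_ofReal (h0 _)]

theorem integrable_density_mul (hℓ : Measurable ℓ) (h0 : ∀ x, 0 ≤ ℓ x)
    (hP : P = Q.withDensity fun x => ENNReal.ofReal (ℓ x)) {f : X → ℝ} (hf : Integrable f P) :
    Integrable (fun x => ℓ x * f x) Q := by
  rw [hP, integrable_withDensity_iff_integrable_smul' hℓ.ennreal_ofReal
    (Eventually.of_forall fun x => ENNReal.ofReal_lt_top)] at hf
  simpa [ENNReal.toReal_ofReal (h0 _)] using hf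

theorem integral_density [IsProbabilityMeasure P] (hℓ : Measurable ℓ) (h0 : ∀ x, 0 ≤ ℓ x)
    (hP : P = Q.withDensity fun x => ENNReal.ofReal (ℓ x)) : ∫ x, ℓ x ∂Q = 1 := by
  have := integral_eq_integral_density_mul hℓ h0 hP fun _ => 1
  simpa using this.symm

theorem integrable_of_bounded [IsFiniteMeasure Q] {f : X → ℝ} (hf : Measurable f)
    (h0 : ∀ x, 0 ≤ f x) (hB : ∀ x, f x ≤ B) : Integrable f Q :=
  Integrable.of_bound hf.aestronglyMeasurable B
    (Eventually.of_forall fun x => by rw [Real.norm_of_nonneg (h0 x)]; exact hB x)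

/-- The set `{ℓ ≥ 1 / 2}` is not negligible, as `ℓ` has mean one. -/
theorem integral_bulk_pos [IsProbabilityMeasure P] [IsProbabilityMeasure Q]
    (hℓ : Measurable ℓ) (h0 : ∀ x, 0 ≤ ℓ x) (hB : ∀ x, ℓ x ≤ B)
    (hP : P = Q.withDensity fun x => ENNReal.ofReal (ℓ x)) : 0 < ∫ x, bulk ℓ x ∂Q := by
  have hb : Integrable (bulk ℓ) Q :=
    integrable_of_bounded (measurable_bulk hℓ) (bulk_nonneg ℓ) (bulk_le_one ℓ)
  have hle : ∀ x, ℓ x ≤ 1 / 2 + B * bulk ℓ x := fun x => by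
    rcases le_or_gt (1 / 2) (ℓ x) with h | h
    · rw [bulk_of_le h]; linarith [hB x]
    · rw [bulk_of_lt h]; linarith
  have h1 : (1 : ℝ) ≤ 1 / 2 + B * ∫ x, bulk ℓ x ∂Q := by
    refine (integral_density hℓ h0 hP).symm.trans_le ((integral_mono (integrable_of_bounded hℓ h0 hB)
      ((integrable_const _).add (hb.const_mul B)) hle).trans_eq ?_)
    rw [integral_add' (integrable_const _) (hb.const_mul B), integral_const_mul]
    simp
  refine (integral_nonneg (bulk_nonneg ℓ)).lt_of_ne fun h => ?_
  rw [← h] at h1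
  norm_num at h1

end Density

/-! ### The reweighted empirical distribution -/

section Tilt

variable {X : Type*}

/-- The multiple of `bulk ℓ` whose addition to `ℓ` gives sample mean one. It has the junk value `0` if
no sampled point lies in `{ℓ ≥ 1 / 2}`. -/
noncomputable def tiltCoeff (ℓ : X → ℝ) (n : ℕ) (z : ℕ → X) : ℝ :=
  (1 - sampleMean n ℓ z) / sampleMean n (bulk ℓ) z

/-- The likelihood ratio `ℓ`, corrected to have sample mean one. The correction is made where `ℓ`
is at least `1 / 2`, and not by scaling, since a divergence function may vary arbitrarily fast
near `0`. -/
noncomputable def tilt (ℓ : X → ℝ) (n : ℕ) (z : ℕ → X) (x : X) : ℝ :=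
  ℓ x + tiltCoeff ℓ n z * bulk ℓ x

/-- The empirical distribution, reweighted by `tilt`. -/
noncomputable def tilted [MeasurableSpace X] (ℓ : X → ℝ) (n : ℕ) (z : ℕ → X) : Measure X :=
  (empirical n z).withDensity fun x => ENNReal.ofReal (tilt ℓ n z x)

variable {ℓ : X → ℝ} {n : ℕ} {z : ℕ → X}

theorem sampleMean_tilt_mul (f : X → ℝ) :
    sampleMean n (fun x => tilt ℓ n z x * f x) z =
      sampleMean n (fun x => ℓ x * f x) z +
        tiltCoeff ℓ n z * sampleMean n (fun x => bulk ℓ x * f x) z := by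
  simp only [sampleMean, tilt, add_mul, Finset.sum_add_distrib, mul_assoc, ← Finset.mul_sum]
  ring

theorem sampleMean_tilt (h : sampleMean n (bulk ℓ) z ≠ 0) : sampleMean n (tilt ℓ n z) z = 1 := by
  have := sampleMean_tilt_mul (ℓ := ℓ) (n := n) (z := z) fun _ => 1
  simp only [mul_one] at this
  rw [show tilt ℓ n z = fun x => tilt ℓ n z x from rfl, this, tiltCoeff,
    show (fun x => bulk ℓ x) = bulk ℓ from rfl, div_mul_cancel₀ _ h]
  ring

/-- The cost of the correction. This needs no lower bound on `sampleMean n (bulk ℓ) z`, whose size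
cancels; where it is zero, `tilt` equals `ℓ`. -/
theorem sampleMean_abs_tilt_sub_le :
    sampleMean n (fun x => |tilt ℓ n z x - ℓ x|) z ≤ |sampleMean n ℓ z - 1| := by
  have hq : 0 ≤ sampleMean n (bulk ℓ) z :=
    div_nonneg (Finset.sum_nonneg fun j _ => bulk_nonneg ℓ _) (Nat.cast_nonneg _)
  have h1 : sampleMean n (fun x => |tilt ℓ n z x - ℓ x|) z =
      |tiltCoeff ℓ n z| * sampleMean n (bulk ℓ) z := by
    simp only [sampleMean, tilt, add_sub_cancel_left, abs_mul, abs_of_nonneg (bulk_nonneg ℓ _),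
      ← Finset.mul_sum, mul_div_assoc]
  rw [h1, tiltCoeff, abs_div, abs_of_nonneg hq, abs_sub_comm]
  rcases hq.eq_or_lt with h | h
  · rw [← h, mul_zero]; exact abs_nonneg _
  · rw [div_mul_cancel₀ _ h.ne']

theorem tendsto_tiltCoeff {q : ℝ} (hq : 0 < q)
    (h1 : Tendsto (fun n => sampleMean n ℓ z) atTop (𝓝 1))
    (h2 : Tendsto (fun n => sampleMean n (bulk ℓ) z) atTop (𝓝 q)) :
    Tendsto (fun n => tiltCoeff ℓ n z) atTop (𝓝 0) := by
  have := (h1.const_sub 1).div h2 hq.ne'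
  simpa [tiltCoeff, Pi.div_def] using this

theorem tilt_nonneg (h0 : ∀ x, 0 ≤ ℓ x) (ha : |tiltCoeff ℓ n z| ≤ 1 / 4) (x : X) :
    0 ≤ tilt ℓ n z x := by
  rcases le_or_gt (1 / 2) (ℓ x) with h | h
  · rw [tilt, bulk_of_le h]; linarith [(abs_le.1 ha).1]
  · rw [tilt, bulk_of_lt h]; linarith [h0 x]

variable [MeasurableSpace X]

theorem measurable_tilt (hℓ : Measurable ℓ) : Measurable (tilt ℓ n z) :=
  hℓ.add ((measurable_bulk hℓ).const_mul _)

variable [MeasurableSingletonClass X]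

theorem integral_tilted (hℓ : Measurable ℓ) (hpos : ∀ x, 0 ≤ tilt ℓ n z x) (f : X → ℝ) :
    ∫ x, f x ∂(tilted ℓ n z) = sampleMean n (fun x => tilt ℓ n z x * f x) z := by
  rw [tilted, integral_withDensity_eq_integral_toReal_smul (measurable_tilt hℓ).ennreal_ofReal
    (Eventually.of_forall fun x => ENNReal.ofReal_lt_top), ← integral_empirical]
  simp [ENNReal.toReal_ofReal (hpos _)]

theorem isProbabilityMeasure_tilted (hℓ : Measurable ℓ) (hpos : ∀ x, 0 ≤ tilt ℓ n z x)
    (hq : sampleMean n (bulk ℓ) z ≠ 0) : IsProbabilityMeasure (tilted ℓ n z) := by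
  have h := integral_tilted hℓ hpos fun _ => 1
  simp only [mul_one] at h
  rw [show (fun x => tilt ℓ n z x) = tilt ℓ n z from rfl, sampleMean_tilt hq] at h
  simp only [integral_const, smul_eq_mul, mul_one] at h
  refine ⟨?_⟩
  rw [← ENNReal.ofReal_one, ← h, measureReal_def, ENNReal.ofReal_toReal]
  intro h'
  simp [measureReal_def, h'] at h

theorem eventually_isProbabilityMeasure_tilted {q : ℝ} (hq : 0 < q) (hℓ : Measurable ℓ)
    (h0 : ∀ x, 0 ≤ ℓ x)
    (h1 : Tendsto (fun n => sampleMean n ℓ z) atTop (𝓝 1))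
    (h2 : Tendsto (fun n => sampleMean n (bulk ℓ) z) atTop (𝓝 q)) :
    ∀ᶠ n in atTop, (∀ x, 0 ≤ tilt ℓ n z x) ∧ IsProbabilityMeasure (tilted ℓ n z) := by
  filter_upwards [(tendsto_tiltCoeff hq h1 h2).abs.eventually_le_const
    (show |(0 : ℝ)| < 1 / 4 by norm_num), h2.eventually_ne hq.ne'] with n ha hn
  exact ⟨tilt_nonneg h0 ha, isProbabilityMeasure_tilted hℓ (tilt_nonneg h0 ha) hn⟩

theorem eventually_tilted_mem_moment {q : ℝ} (hq : 0 < q) (hℓ : Measurable ℓ) (h0 : ∀ x, 0 ≤ ℓ x)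
    (h1 : Tendsto (fun n => sampleMean n ℓ z) atTop (𝓝 1))
    (h2 : Tendsto (fun n => sampleMean n (bulk ℓ) z) atTop (𝓝 q))
    {s : ℕ} {f : Fin s → X → ℝ} {b e k : Fin s → ℝ} (heb : ∀ l, e l < b l)
    (hf : ∀ l, Tendsto (fun n => sampleMean n (fun x => ℓ x * f l x) z) atTop (𝓝 (e l)))
    (hk : ∀ l, Tendsto (fun n => sampleMean n (fun x => bulk ℓ x * f l x) z) atTop (𝓝 (k l))) :
    ∀ᶠ n in atTop, tilted ℓ n z ∈ sampledSet (.moment s f b) n z := by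
  have hlim : ∀ l, Tendsto (fun n => sampleMean n (fun x => tilt ℓ n z x * f l x) z) atTop
      (𝓝 (e l)) := fun l => by
    simp only [sampleMean_tilt_mul]
    simpa using (hf l).add ((tendsto_tiltCoeff hq h1 h2).mul (hk l))
  filter_upwards [eventually_isProbabilityMeasure_tilted hq hℓ h0 h1 h2, eventually_ne_atTop 0,
    eventually_all.2 fun l => (hlim l).eventually_le_const (heb l)] with n ⟨hpos, hprob⟩ hn hle
  refine ⟨hprob, withDensity_absolutelyContinuous _ _ ?_, fun l => ?_⟩
  · refine measure_eq_zero_iff_ae_notMem.2 ((ae_empirical_iff z).2 fun j hj => ?_)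
    simpa using ⟨j, hj, rfl⟩
  · rw [integral_tilted hℓ hpos]
    exact hle l

theorem eventually_tilted_mem_divergence {q : ℝ} (hq : 0 < q) (hℓ : Measurable ℓ)
    (h0 : ∀ x, 0 ≤ ℓ x) {B : ℝ} (hB : ∀ x, ℓ x ≤ B)
    (h1 : Tendsto (fun n => sampleMean n ℓ z) atTop (𝓝 1))
    (h2 : Tendsto (fun n => sampleMean n (bulk ℓ) z) atTop (𝓝 q))
    {φ : ℝ → EReal} (hφ : IsDivergenceFunction φ) {d η : ℝ} (hd : d < η)
    (hfin : ∀ j, φ (ℓ (z j)) ≠ ⊤)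
    (hlim : Tendsto (fun n => sampleMean n (fun x => (φ (ℓ x)).toReal) z) atTop (𝓝 d)) :
    ∀ᶠ n in atTop, tilted ℓ n z ∈ sampledSet (.divergence φ η) n z := by
  obtain ⟨ε, hε, hdε⟩ : ∃ ε : ℝ, 0 < ε ∧ d + ε < η := ⟨(η - d) / 2, by linarith, by linarith⟩
  -- Only arguments in this compact subset of `(0, ∞)` are moved by the correction.
  have hcont : ContinuousOn (fun x => (φ x).toReal) (Set.Icc (1 / 4) (B + 1)) := fun x hx =>
    (hφ.differentiable x (by linarith [hx.1])).continuousAt.continuousWithinAt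
  obtain ⟨δ, hδ, huc⟩ := Metric.uniformContinuousOn_iff.1
    (isCompact_Icc.uniformContinuousOn_of_continuous hcont) ε hε
  have hcoef := (tendsto_tiltCoeff hq h1 h2).abs
  rw [abs_zero] at hcoef
  filter_upwards [eventually_isProbabilityMeasure_tilted hq hℓ h0 h1 h2, eventually_ne_atTop 0,
    hcoef.eventually_le_const (show (0 : ℝ) < 1 / 4 by norm_num), hcoef.eventually_lt_const hδ,
    hlim.eventually_le_const (show d < η - ε by linarith)] with n ⟨hpos, hprob⟩ hn ha haδ hle
  have : NeZero n := ⟨hn⟩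
  have hdens : ∀ j < n, ((tilted ℓ n z).rnDeriv (empirical n z) (z j)).toReal =
      tilt ℓ n z (z j) := by
    refine (ae_empirical_iff (p := fun x => ((tilted ℓ n z).rnDeriv (empirical n z) x).toReal =
      tilt ℓ n z x) z).1 ?_
    filter_upwards [Measure.rnDeriv_withDensity (empirical n z)
      (measurable_tilt (n := n) (z := z) hℓ).ennreal_ofReal] with x hx
    rw [tilted, hx, ENNReal.toReal_ofReal (hpos x)]
  have hφt : ∀ j, φ (tilt ℓ n z (z j)) ≠ ⊤ ∧
      (φ (tilt ℓ n z (z j))).toReal ≤ (φ (ℓ (z j))).toReal + ε := by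
    intro j
    rcases le_or_gt (1 / 2) (ℓ (z j)) with h | h
    · have ht : tilt ℓ n z (z j) = ℓ (z j) + tiltCoeff ℓ n z := by
        rw [tilt, bulk_of_le h, mul_one]
      obtain ⟨ha1, ha2⟩ := abs_le.1 ha
      have h3 := huc (tilt ℓ n z (z j)) ⟨by linarith, by linarith [hB (z j)]⟩ (ℓ (z j))
        ⟨by linarith, by linarith [hB (z j)]⟩
        (by rw [ht, Real.dist_eq, add_sub_cancel_left]; exact haδ)
      rw [Real.dist_eq] at h3
      exact ⟨(hφ.finite _ (by linarith)).1, by linarith [(abs_lt.1 h3).2]⟩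
    · have ht : tilt ℓ n z (z j) = ℓ (z j) := by rw [tilt, bulk_of_lt h]; ring
      rw [ht]
      exact ⟨hfin j, by linarith⟩
  refine ⟨hprob, ?_⟩
  have hne : ∀ᵐ x ∂(empirical n z),
      φ ((tilted ℓ n z).rnDeriv (empirical n z) x).toReal ≠ ⊤ := by
    refine (ae_empirical_iff z).2 fun j hj => ?_
    rw [hdens j hj]
    exact (hφt j).1
  rw [phiDiv, if_pos ⟨withDensity_absolutelyContinuous _ _, hne, integrable_empirical hn _ _⟩]
  rw [EReal.coe_le_coe_iff, integral_empirical]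
  refine le_trans ?_ (show sampleMean n (fun x => (φ (ℓ x)).toReal) z + ε ≤ η by linarith)
  have hε' : ε = (∑ j ∈ Finset.range n, ε) / n := by
    rw [Finset.sum_const, Finset.card_range, nsmul_eq_mul, mul_div_cancel_left₀]
    exact_mod_cast hn
  rw [sampleMean, sampleMean]
  conv_rhs => rw [hε', ← add_div, ← Finset.sum_add_distrib]
  refine div_le_div_of_nonneg_right (Finset.sum_le_sum fun j hj => ?_) (Nat.cast_nonneg _)
  rw [hdens j (Finset.mem_range.1 hj)]
  exact (hφt j).2

end Tilt

/-! ### Almost sure feasibility -/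

section Membership

variable {Ω I : Type*} [MeasurableSpace Ω] {μ : Measure Ω}
  {X : I → Type*} [∀ i, MeasurableSpace (X i)] [∀ i, MeasurableSingletonClass (X i)]
  {Q : ∀ i, Measure (X i)} [∀ i, IsProbabilityMeasure (Q i)] {y : ∀ i, ℕ → Ω → X i}

theorem Regular.absolutelyContinuous_and_essSup_lt_top {X : Type*} [MeasurableSpace X]
    {P Q : Measure X} {c : ModelConstraint X} (hc : Regular P Q c) :
    P ≪ Q ∧ essSup (P.rnDeriv Q) Q < ⊤ := by
  cases c with
  | moment s f b => exact ⟨hc.1, hc.2.1⟩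
  | divergence φ η => exact ⟨hc.2.1, hc.2.2.1⟩

/-- Almost surely the reweighted empirical distribution is a probability distribution in the sampled
uncertainty set once the sample is large. -/
theorem ae_eventually_tilted_mem (hy : ∀ i j, Measurable (y i j))
    (hlaw : ∀ i j, μ.map (y i j) = Q i)
    (hindep : iIndepFun (fun (p : I × ℕ) => y p.1 p.2) μ) (i : I)
    {P : Measure (X i)} [IsProbabilityMeasure P] {c : ModelConstraint (X i)}
    (hc : Regular P (Q i) c) {ℓ : X i → ℝ} {B : ℝ} (hℓ : Measurable ℓ) (h0 : ∀ x, 0 ≤ ℓ x)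
    (hB : ∀ x, ℓ x ≤ B) (hP : P = (Q i).withDensity fun x => ENNReal.ofReal (ℓ x))
    (hdens : ∀ᵐ x ∂(Q i), (P.rnDeriv (Q i) x).toReal = ℓ x) :
    ∀ᵐ ω ∂μ, ∀ᶠ n in atTop, (∀ x, 0 ≤ tilt ℓ n (fun j => y i j ω) x) ∧
      tilted ℓ n (fun j => y i j ω) ∈ sampledSet c n fun j => y i j ω := by
  have hq := integral_bulk_pos hℓ h0 hB hP
  have h1 := tendsto_sampleMean hy hlaw hindep i (integrable_of_bounded (Q := Q i) hℓ h0 hB)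
  rw [integral_density hℓ h0 hP] at h1
  have h2 := tendsto_sampleMean hy hlaw hindep i (integrable_of_bounded (Q := Q i)
    (measurable_bulk hℓ) (bulk_nonneg ℓ) (bulk_le_one ℓ))
  cases c with
  | moment s f b =>
    obtain ⟨-, -, hf⟩ := hc
    have hfP : ∀ l, Integrable (f l) P := fun l =>
      ((memLp_two_iff_integrable_sq (hf l).1.aestronglyMeasurable).2 (hf l).2.1).integrable
        one_le_two
    have hfQ : ∀ l, Integrable (fun x => ℓ x * f l x) (Q i) := fun l =>
      integrable_density_mul hℓ h0 hP (hfP l)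
    -- On the set where `ℓ ≥ 1 / 2`, integrability under `P` gives integrability under `Q i`.
    have hbQ : ∀ l, Integrable (fun x => bulk ℓ x * f l x) (Q i) := fun l => by
      refine ((hfQ l).const_mul 2).mono ((measurable_bulk hℓ).mul (hf l).1).aestronglyMeasurable
        (Eventually.of_forall fun x => ?_)
      rw [norm_mul, norm_mul, norm_mul, ← mul_assoc]
      refine mul_le_mul_of_nonneg_right ?_ (norm_nonneg _)
      rw [Real.norm_of_nonneg (bulk_nonneg ℓ x), Real.norm_of_nonneg (h0 x), Real.norm_ofNat]
      rcases le_or_gt (1 / 2) (ℓ x) with h | h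
      · rw [bulk_of_le h]; linarith
      · rw [bulk_of_lt h]; linarith [h0 x]
    filter_upwards [h1, h2, ae_all_iff.2 fun l => tendsto_sampleMean hy hlaw hindep i (hfQ l),
      ae_all_iff.2 fun l => tendsto_sampleMean hy hlaw hindep i (hbQ l)] with ω g1 g2 g3 g4
    refine ((eventually_isProbabilityMeasure_tilted hq hℓ h0 g1 g2).mono fun n h => h.1).and
      (eventually_tilted_mem_moment hq hℓ h0 g1 g2 (fun l => ?_) g3 g4)
    rw [← integral_eq_integral_density_mul hℓ h0 hP]
    exact (hf l).2.2
  | divergence φ η =>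
    obtain ⟨hφ, -, -, hdiv, -⟩ := hc
    rw [phiDiv] at hdiv
    split_ifs at hdiv with hcond
    · obtain ⟨-, htop, hint⟩ := hcond
      have hae : (fun x => (φ (P.rnDeriv (Q i) x).toReal).toReal) =ᵐ[Q i]
          fun x => (φ (ℓ x)).toReal := hdens.mono fun x hx => by simp only [hx]
      have hfin : ∀ᵐ x ∂(Q i), φ (ℓ x) ≠ ⊤ := by
        filter_upwards [htop, hdens] with x hx hx'
        rwa [← hx']
      rw [integral_congr_ae hae, EReal.coe_lt_coe_iff] at hdiv
      filter_upwards [h1, h2, ae_all_sample hy hlaw i hfin,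
        tendsto_sampleMean hy hlaw hindep i (hint.congr hae)] with ω g1 g2 g3 g4
      exact ((eventually_isProbabilityMeasure_tilted hq hℓ h0 g1 g2).mono fun n h => h.1).and
        (eventually_tilted_mem_divergence hq hℓ h0 hB g1 g2 hφ hdiv g3 g4)
    · exact absurd hdiv (by simp)

end Membership

/-! ### Rate of convergence -/

/-- Chebyshev's inequality: a mean square `O(1 / n)` gives `O_p(1 / √n)`. -/
theorem isBigOInProb_of_integral_sq_le {Ω : Type*} [MeasurableSpace Ω] {μ : Measure Ω}
    [IsFiniteMeasure μ] {R : ℕ → Ω → ℝ} {C : ℝ} (hC : 0 ≤ C)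
    (hint : ∀ n, 0 < n → Integrable (fun ω => R n ω ^ 2) μ)
    (hle : ∀ n : ℕ, 0 < n → ∫ ω, R n ω ^ 2 ∂μ ≤ C / n) :
    IsBigOInProb μ R fun n => 1 / √(n : ℝ) := by
  intro ε hε
  have hM : 0 ≤ C / ε := by positivity
  refine ⟨1 + C / ε, ?_⟩
  filter_upwards [eventually_gt_atTop 0] with n hn
  have hn' : (0 : ℝ) < n := by exact_mod_cast hn
  set M : ℝ := 1 + C / ε with hMdef
  have hsub : {ω | M * (1 / √(n : ℝ)) < |R n ω|} ⊆ {ω | M ^ 2 / n ≤ R n ω ^ 2} := by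
    intro ω hω
    have h1 : (M * (1 / √(n : ℝ))) ^ 2 ≤ |R n ω| ^ 2 :=
      pow_le_pow_left₀ (by positivity) (le_of_lt hω) 2
    rw [mul_pow, div_pow, one_pow, Real.sq_sqrt hn'.le, sq_abs] at h1
    simpa [div_eq_mul_inv] using h1
  have hmarkov := mul_meas_ge_le_integral_of_nonneg (μ := μ)
    (Eventually.of_forall fun ω => sq_nonneg (R n ω)) (hint n hn) (M ^ 2 / n)
  have hreal : μ.real {ω | M ^ 2 / n ≤ R n ω ^ 2} ≤ ε := by
    have h2 := hmarkov.trans (hle n hn)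
    rw [div_mul_eq_mul_div, div_le_div_iff_of_pos_right hn'] at h2
    have hM1 : 1 ≤ M := by linarith
    have h3 : C ≤ M ^ 2 * ε := by
      have : C = C / ε * ε := by field_simp
      rw [this]
      exact mul_le_mul_of_nonneg_right (by nlinarith) hε.le
    exact le_of_mul_le_mul_left (h2.trans h3) (by positivity)
  refine (measure_mono hsub).trans ?_
  rw [← ENNReal.ofReal_toReal (measure_ne_top μ _)]
  exact ENNReal.ofReal_le_ofReal hreal

theorem abs_sampleMean_le {X : Type*} {n : ℕ} {f : X → ℝ} {C : ℝ} (h0 : 0 ≤ C)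
    (hC : ∀ x, |f x| ≤ C) (z : ℕ → X) : |sampleMean n f z| ≤ C := by
  rw [sampleMean, abs_div, Nat.abs_cast]
  refine div_le_of_le_mul₀ (Nat.cast_nonneg n) h0 ((Finset.abs_sum_le_sum_abs _ _).trans
    ((Finset.sum_le_sum fun j _ => hC (z j)).trans_eq ?_))
  simp [mul_comm]

theorem abs_vStat_le {S : Type*} [Fintype S] [DecidableEq S] {X : S → Type*} {N : S → ℕ}
    {z : ∀ s, ℕ → X s} {g : (∀ s, X s) → ℝ} {C : ℝ} (h0 : 0 ≤ C) (hC : ∀ x, |g x| ≤ C) :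
    |vStat N z g| ≤ C := by
  have hpos : (0 : ℝ) ≤ ∏ s, (N s : ℝ) := by positivity
  rw [vStat, ← div_eq_inv_mul, abs_div, abs_of_nonneg hpos]
  refine div_le_of_le_mul₀ hpos h0 ((Finset.abs_sum_le_sum_abs _ _).trans
    ((Finset.sum_le_sum fun J _ => hC fun s => z s (J s)).trans_eq ?_))
  simp [mul_comm]

section Sampling

variable {Ω I : Type*} [MeasurableSpace Ω] {X : I → Type*} [∀ i, MeasurableSpace (X i)]
  {y : ∀ i, ℕ → Ω → X i}

theorem measurable_sampleMean (hy : ∀ i j, Measurable (y i j)) (i : I) (n : ℕ) {f : X i → ℝ}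
    (hf : Measurable f) : Measurable fun ω => sampleMean n f fun j => y i j ω :=
  (Finset.measurable_sum _ fun j _ => hf.comp (hy i j)).div_const _

theorem measurable_vStat {S : Type*} [Fintype S] [DecidableEq S] (hy : ∀ i j, Measurable (y i j))
    (c : S → I) (N : S → ℕ) {g : Ω → (∀ s, X (c s)) → ℝ}
    (hg : Measurable fun p : Ω × (∀ s, X (c s)) => g p.1 p.2) :
    Measurable fun ω => vStat N (fun s j => y (c s) j ω) (g ω) := by
  refine (Finset.measurable_sum _ fun J _ => ?_).const_mul _
  exact hg.comp (measurable_id.prodMk (measurable_pi_lambda _ fun s => hy (c s) (J s)))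

theorem measurable_tilted_vStat {S : Type*} [Fintype S] [DecidableEq S]
    (hy : ∀ i j, Measurable (y i j)) (c : S → I) {ℓ : ∀ i, X i → ℝ} (hℓ : ∀ i, Measurable (ℓ i))
    {g : (∀ s, X (c s)) → ℝ} (hg : Measurable g) (N : S → ℕ) :
    Measurable fun ω => vStat N (fun s j => y (c s) j ω)
      fun x => (∏ s, tilt (ℓ (c s)) (N s) (fun j => y (c s) j ω) (x s)) * g x := by
  refine measurable_vStat hy c N ?_
  refine (Finset.measurable_prod _ fun s _ => ?_).mul (hg.comp measurable_snd)
  have hx : Measurable fun p : Ω × (∀ s, X (c s)) => p.2 s :=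
    (measurable_pi_apply s).comp measurable_snd
  refine ((hℓ (c s)).comp hx).add (Measurable.mul ?_ ((measurable_bulk (hℓ (c s))).comp hx))
  exact ((measurable_const.sub (measurable_sampleMean hy (c s) (N s) (hℓ (c s)))).div
    (measurable_sampleMean hy (c s) (N s) (measurable_bulk (hℓ (c s))))).comp measurable_fst

variable {μ : Measure Ω} [IsProbabilityMeasure μ] {Q : ∀ i, Measure (X i)}
  [∀ i, IsProbabilityMeasure (Q i)]

/-- Mean square error of the V-statistic with kernel `g` under the reweighted empirical
distributions, as an estimator of `∫ g` under the product of the `ℓ i · Q i`. Replacing the weight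
`tilt` by `ℓ` costs at most a multiple of `∑ |sampleMean ℓ - 1|`. -/
theorem integral_tilted_vStat_sub_sq_le {S : Type*} [Fintype S] [DecidableEq S]
    (hy : ∀ i j, Measurable (y i j)) (hlaw : ∀ i j, μ.map (y i j) = Q i)
    (hindep : iIndepFun (fun (p : I × ℕ) => y p.1 p.2) μ) (c : S → I)
    {P : ∀ i, Measure (X i)} [∀ i, IsProbabilityMeasure (P i)] {ℓ : ∀ i, X i → ℝ} {K : ℝ}
    (hℓ : ∀ i, Measurable (ℓ i)) (h0 : ∀ i x, 0 ≤ ℓ i x) (hK : ∀ i x, ℓ i x ≤ K) (hK1 : 1 ≤ K)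
    (hP : ∀ i, P i = (Q i).withDensity fun x => ENNReal.ofReal (ℓ i x))
    {g : (∀ s, X (c s)) → ℝ} (hg : Measurable g) {M : ℝ} (hM0 : 0 ≤ M) (hM : ∀ x, |g x| ≤ M) :
    ∃ C : ℝ, 0 ≤ C ∧ ∀ (N : S → ℕ) (r : ℝ), 0 < r → (∀ s, r ≤ N s) →
      Integrable (fun ω => (vStat N (fun s j => y (c s) j ω)
        (fun x => (∏ s, tilt (ℓ (c s)) (N s) (fun j => y (c s) j ω) (x s)) * g x) -
          ∫ x, g x ∂(Measure.pi fun s => P (c s))) ^ 2) μ ∧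
      ∫ ω, (vStat N (fun s j => y (c s) j ω)
        (fun x => (∏ s, tilt (ℓ (c s)) (N s) (fun j => y (c s) j ω) (x s)) * g x) -
          ∫ x, g x ∂(Measure.pi fun s => P (c s))) ^ 2 ∂μ ≤ C / r := by
  set Z := ∫ x, g x ∂(Measure.pi fun s => P (c s)) with hZ
  set G : (∀ s, X (c s)) → ℝ := fun x => (∏ s, ℓ (c s) (x s)) * g x with hGdef
  set k : ℝ := (Fintype.card S : ℝ) with hk
  have hK0 : 0 ≤ K := zero_le_one.trans hK1
  have hG : Measurable G := by
    refine (Finset.measurable_prod _ fun s _ => ?_).mul hg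
    exact (hℓ (c s)).comp (measurable_pi_apply s)
  set D : ℝ := K ^ Fintype.card S * M with hD
  have hD0 : 0 ≤ D := by positivity
  have hGD : ∀ x, |G x| ≤ D := fun x => by
    rw [hGdef, abs_mul, Finset.abs_prod]
    refine mul_le_mul ?_ (hM x) (abs_nonneg _) (by positivity)
    rw [← Finset.card_univ, ← Finset.prod_const]
    exact Finset.prod_le_prod (fun s _ => abs_nonneg _) fun s _ => by
      rw [abs_of_nonneg (h0 _ _)]; exact hK _ _
  have hGZ : ∫ x, G x ∂(Measure.pi fun s => Q (c s)) = Z := by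
    rw [hZ]
    simp only [hP]
    exact (integral_pi_withDensity (fun s => Q (c s)) (w := fun s => ℓ (c s)) (fun s => hℓ _)
      (fun s => h0 _) g).symm
  have hZD : |Z| ≤ D := by
    have := norm_integral_le_of_norm_le_const (μ := Measure.pi fun s => Q (c s)) (f := G)
      (Eventually.of_forall hGD)
    rw [hGZ] at this
    simpa using this
  set A : ℝ := M * (2 * K + 1) ^ Fintype.card S with hA
  refine ⟨2 * (12 * D ^ 2 * k ^ 2) + 2 * A ^ 2 * k * (k * (12 * K ^ 2)), by positivity,
    fun N r hr hN => ?_⟩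
  set V : Ω → ℝ := fun ω => vStat N (fun s j => y (c s) j ω) G - Z with hV
  set W : S → Ω → ℝ := fun s ω => sampleMean (N s) (ℓ (c s)) (fun j => y (c s) j ω) - 1 with hW
  set R : Ω → ℝ := fun ω => vStat N (fun s j => y (c s) j ω)
    (fun x => (∏ s, tilt (ℓ (c s)) (N s) (fun j => y (c s) j ω) (x s)) * g x) - Z with hR
  have hVm : Measurable V := (measurable_vStat hy c N (g := fun _ => G)
    (hG.comp measurable_snd)).sub_const Z
  have hWm : ∀ s, Measurable (W s) := fun s =>
    (measurable_sampleMean hy (c s) (N s) (hℓ (c s))).sub_const 1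
  have hℓK : ∀ i x, |ℓ i x| ≤ K := fun i x => by rw [abs_of_nonneg (h0 i x)]; exact hK i x
  have hWb : ∀ s ω, |W s ω| ≤ K + 1 := fun s ω => by
    refine (abs_sub _ _).trans ?_
    rw [abs_one]
    linarith [abs_sampleMean_le (n := N s) hK0 (hℓK (c s)) fun j => y (c s) j ω]
  have hVint : Integrable (fun ω => V ω ^ 2) μ := by
    refine Integrable.of_bound (hVm.pow_const 2).aestronglyMeasurable ((D + D) ^ 2)
      (Eventually.of_forall fun ω => ?_)
    rw [norm_pow, Real.norm_eq_abs]
    refine pow_le_pow_left₀ (abs_nonneg _) ((abs_sub _ _).trans (add_le_add ?_ hZD)) 2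
    exact abs_vStat_le hD0 hGD
  have hWint : ∀ s, Integrable (fun ω => W s ω ^ 2) μ := fun s => by
    refine Integrable.of_bound ((hWm s).pow_const 2).aestronglyMeasurable ((K + 1) ^ 2)
      (Eventually.of_forall fun ω => ?_)
    rw [norm_pow, Real.norm_eq_abs]
    exact pow_le_pow_left₀ (abs_nonneg _) (hWb s ω) 2
  have hVle : ∫ ω, V ω ^ 2 ∂μ ≤ 12 * D ^ 2 * k ^ 2 / r := by
    have := integral_vStat_sub_sq_le hy hlaw hindep c hG hGD N hr hN
    rwa [hGZ] at this
  have hWle : ∀ s, ∫ ω, W s ω ^ 2 ∂μ ≤ 12 * K ^ 2 / r := fun s => by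
    have := integral_sampleMean_sub_sq_le hy hlaw hindep (c s) (hℓ (c s)) (hℓK (c s)) (N s) hr
      (hN s)
    rwa [integral_density (hℓ _) (h0 _) (hP _)] at this
  have hRm : Measurable R :=
    (measurable_tilted_vStat hy c hℓ hg N).sub_const Z
  have hRabs : ∀ ω, |R ω| ≤ |V ω| + A * ∑ s, |W s ω| := by
    intro ω
    have h1 : |R ω - V ω| ≤ A * ∑ s, |W s ω| := by
      have hsub := abs_vStat_prod_mul_sub_le N (fun s j => y (c s) j ω) (fun s => ℓ (c s))
        (fun s => tilt (ℓ (c s)) (N s) (fun j => y (c s) j ω)) hM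
      have hb : ∀ s, 0 ≤ sampleMean (N s) (fun x => |ℓ (c s) x|) (fun j => y (c s) j ω) :=
        fun s => div_nonneg (Finset.sum_nonneg fun j _ => abs_nonneg _) (Nat.cast_nonneg _)
      have hbK : ∀ s, sampleMean (N s) (fun x => |ℓ (c s) x|) (fun j => y (c s) j ω) ≤ K :=
        fun s => (le_abs_self _).trans
          (abs_sampleMean_le hK0 (fun x => by rw [abs_abs]; exact hℓK _ x) _)
      have hd : ∀ s, 0 ≤ sampleMean (N s)
          (fun x => |tilt (ℓ (c s)) (N s) (fun j => y (c s) j ω) x - ℓ (c s) x|)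
          (fun j => y (c s) j ω) :=
        fun s => div_nonneg (Finset.sum_nonneg fun j _ => abs_nonneg _) (Nat.cast_nonneg _)
      have hdW : ∀ s, sampleMean (N s)
          (fun x => |tilt (ℓ (c s)) (N s) (fun j => y (c s) j ω) x - ℓ (c s) x|)
          (fun j => y (c s) j ω) ≤ |W s ω| := fun s => sampleMean_abs_tilt_sub_le
      have h2 := prod_add_sub_prod_le Finset.univ (K := 2 * K + 1) (by linarith) hb hd
        fun s => by linarith [hbK s, (hdW s).trans (hWb s ω)]
      have h3 : R ω - V ω = vStat N (fun s j => y (c s) j ω)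
          (fun x => (∏ s, tilt (ℓ (c s)) (N s) (fun j => y (c s) j ω) (x s)) * g x) -
          vStat N (fun s j => y (c s) j ω) G := by
        simp only [hR, hV]; ring
      rw [h3, hA, mul_assoc]
      refine hsub.trans (mul_le_mul_of_nonneg_left (h2.trans ?_) hM0)
      rw [Finset.card_univ]
      exact mul_le_mul_of_nonneg_left (Finset.sum_le_sum fun s _ => hdW s) (by positivity)
    have h4 := abs_add_le (V ω) (R ω - V ω)
    rw [add_sub_cancel] at h4
    linarith
  have hRsq : ∀ ω, R ω ^ 2 ≤ 2 * V ω ^ 2 + 2 * A ^ 2 * k * ∑ s, W s ω ^ 2 := by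
    intro ω
    have h1 : R ω ^ 2 ≤ (|V ω| + A * ∑ s, |W s ω|) ^ 2 := by
      rw [← sq_abs (R ω)]
      exact pow_le_pow_left₀ (abs_nonneg _) (hRabs ω) 2
    have h2 : (∑ s, |W s ω|) ^ 2 ≤ k * ∑ s, W s ω ^ 2 := by
      have := sq_sum_le_card_mul_sum_sq (s := Finset.univ) (f := fun s => |W s ω|)
      simpa only [sq_abs, Finset.card_univ] using this
    have h3 := add_sq_le (a := |V ω|) (b := A * ∑ s, |W s ω|)
    rw [sq_abs, mul_pow] at h3
    have h4 := mul_le_mul_of_nonneg_left h2 (sq_nonneg A)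
    nlinarith
  have hdom : Integrable (fun ω => 2 * V ω ^ 2 + 2 * A ^ 2 * k * ∑ s, W s ω ^ 2) μ :=
    (hVint.const_mul 2).add ((integrable_finsetSum _ fun s _ => hWint s).const_mul _)
  have hRint : Integrable (fun ω => R ω ^ 2) μ := by
    refine hdom.mono' (hRm.pow_const 2).aestronglyMeasurable (Eventually.of_forall fun ω => ?_)
    rw [Real.norm_of_nonneg (sq_nonneg _)]
    exact hRsq ω
  refine ⟨hRint, (integral_mono hRint hdom hRsq).trans ?_⟩
  rw [integral_add (hVint.const_mul 2)
    ((integrable_finsetSum _ fun s _ => hWint s).const_mul _), integral_const_mul,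
    integral_const_mul, integral_finsetSum _ fun s _ => hWint s]
  have hsum : ∑ s, ∫ ω, W s ω ^ 2 ∂μ ≤ k * (12 * K ^ 2 / r) := by
    refine (Finset.sum_le_sum fun s _ => hWle s).trans_eq ?_
    simp [hk]
  calc _ ≤ 2 * (12 * D ^ 2 * k ^ 2 / r) + 2 * A ^ 2 * k * (k * (12 * K ^ 2 / r)) :=
        add_le_add (mul_le_mul_of_nonneg_left hVle zero_le_two)
          (mul_le_mul_of_nonneg_left hsum (by positivity))
    _ = _ := by ring

end Sampling

/-! ### Truncation of the cost function -/

section Performance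

variable {m : ℕ} {X : Fin m → Type*}
  {T : Fin m → ℕ} {h : (∀ i, Fin (T i) → X i) → ℝ}

/-- The truncation to `[-M, M]` of the cost function, with its arguments indexed by one sigma
type. -/
noncomputable def truncCost (h : (∀ i, Fin (T i) → X i) → ℝ) (M : ℝ)
    (x : ∀ s : (Σ i, Fin (T i)), X s.1) : ℝ :=
  max (-M) (min M (h (Sigma.curry x)))

theorem abs_truncCost_le {M : ℝ} (hM : 0 ≤ M) (x : ∀ s : (Σ i, Fin (T i)), X s.1) :
    |truncCost h M x| ≤ M :=
  abs_le.2 ⟨le_max_left _ _, max_le (by linarith) (min_le_left _ _)⟩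

theorem truncCost_eq {M : ℝ} {x : ∀ s : (Σ i, Fin (T i)), X s.1} (hx : |h (Sigma.curry x)| ≤ M) :
    truncCost h M x = h (Sigma.curry x) := by
  rw [truncCost, min_eq_right (abs_le.1 hx).2, max_eq_right (abs_le.1 hx).1]

variable [∀ i, MeasurableSpace (X i)]

theorem measurable_truncCost (hh : Measurable h) (M : ℝ) : Measurable (truncCost h M) :=
  measurable_const.max (measurable_const.min (hh.comp measurable_sigmaCurry))

/-- At the reweighted empirical distributions the performance measure is a V-statistic. Its kernel
may be truncated, because it is only evaluated at arguments made up of sampled points. -/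
theorem perf_tilted [∀ i, MeasurableSingletonClass (X i)] (hh : Measurable h)
    {ℓ : ∀ i, X i → ℝ} (hℓ : ∀ i, Measurable (ℓ i)) {N : Fin m → ℕ} (hN : ∀ i, N i ≠ 0)
    {z : ∀ i, ℕ → X i} (hpos : ∀ i x, 0 ≤ tilt (ℓ i) (N i) (z i) x)
    (hprob : ∀ i, IsProbabilityMeasure (tilted (ℓ i) (N i) (z i))) {M : ℝ}
    (hM : ∀ j : (∀ i, Fin (T i) → ℕ), |h fun i t => z i (j i t)| ≤ M) :
    perf h (fun i => tilted (ℓ i) (N i) (z i)) =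
      vStat (fun s : (Σ i, Fin (T i)) => N s.1) (fun s => z s.1)
        fun x => (∏ s, tilt (ℓ s.1) (N s.1) (z s.1) (x s)) * truncCost h M x := by
  have : ∀ i, NeZero (N i) := fun i => ⟨hN i⟩
  rw [perf_eq_integral_sigma]
  refine (integral_pi_withDensity (fun s : (Σ i, Fin (T i)) => empirical (N s.1) (z s.1))
    (w := fun s => tilt (ℓ s.1) (N s.1) (z s.1)) (fun s => measurable_tilt (hℓ _))
    (fun s => hpos _) _).trans ?_
  rw [integral_pi_empirical (fun s : (Σ i, Fin (T i)) => N s.1) (fun s => hN _)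
    (fun s => z s.1)]
  · simp only [vStat]
    congr 1
    refine Finset.sum_congr rfl fun J _ => ?_
    rw [truncCost_eq]
    exact hM fun i t => J ⟨i, t⟩
  · refine (Finset.measurable_prod _ fun s _ => ?_).mul (hh.comp measurable_sigmaCurry)
    exact (measurable_tilt (hℓ _)).comp (measurable_pi_apply s)

/-- The bound on `h` at arguments made up of observations passes on to almost all arguments under the
product of the `Q i`, hence of the `P i`. -/
theorem perf_eq_integral_truncCost {Ω : Type*} [MeasurableSpace Ω] {μ : Measure Ω}
    [IsProbabilityMeasure μ] {P Q : ∀ i, Measure (X i)} [∀ i, IsProbabilityMeasure (P i)]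
    [∀ i, IsProbabilityMeasure (Q i)] {y : ∀ i, ℕ → Ω → X i} (hh : Measurable h)
    (hy : ∀ i j, Measurable (y i j)) (hlaw : ∀ i j, μ.map (y i j) = Q i)
    (hindep : iIndepFun (fun (p : Fin m × ℕ) => y p.1 p.2) μ) {M : ℝ}
    (hM : ∀ᵐ ω ∂μ, ∀ j : (∀ i, Fin (T i) → ℕ), |h fun i t => y i (j i t) ω| ≤ M)
    {ℓ : ∀ i, X i → ℝ} (hℓ : ∀ i, Measurable (ℓ i))
    (hP : ∀ i, P i = (Q i).withDensity fun x => ENNReal.ofReal (ℓ i x)) :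
    perf h P = ∫ x, truncCost h M x ∂(Measure.pi fun s : (Σ i, Fin (T i)) => P s.1) := by
  rw [perf_eq_integral_sigma]
  -- The argument made up of pairwise distinct observations has the product of the `Q i` as law.
  let J : (Σ i, Fin (T i)) → ℕ := fun s => Fintype.equivFin _ s
  have hJ : Function.Injective J := Fin.val_injective.comp (Equiv.injective _)
  have hae : ∀ᵐ x ∂(Measure.pi fun s : (Σ i, Fin (T i)) => Q s.1), |h (Sigma.curry x)| ≤ M := by
    rw [← map_sample_eq_pi hy hlaw hindep Sigma.fst J hJ,
      ae_map_iff (measurable_pi_lambda _ fun s => hy _ _).aemeasurable]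
    · filter_upwards [hM] with ω hω
      exact hω fun i t => J ⟨i, t⟩
    · exact measurableSet_le (hh.comp measurable_sigmaCurry).abs measurable_const
  have hac : (Measure.pi fun s : (Σ i, Fin (T i)) => P s.1) ≪
      Measure.pi fun s : (Σ i, Fin (T i)) => Q s.1 := by
    have hprob : ∀ i, IsProbabilityMeasure
        ((Q i).withDensity fun x => ENNReal.ofReal (ℓ i x)) := fun i => hP i ▸ inferInstance
    simp only [hP]
    rw [pi_withDensity (fun s : (Σ i, Fin (T i)) => Q s.1) fun s => (hℓ s.1).ennreal_ofReal]
    exact withDensity_absolutelyContinuous _ _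
  exact integral_congr_ae (by
    filter_upwards [hac.ae_le hae] with x hx using (truncCost_eq hx).symm)

theorem isProbabilityMeasure_of_mem_sampledSet {X : Type*} [MeasurableSpace X]
    {c : ModelConstraint X} {n : ℕ} {z : ℕ → X} {P : Measure X} (hP : P ∈ sampledSet c n z) :
    IsProbabilityMeasure P := by
  cases c with
  | moment s f b => exact hP.1
  | divergence φ η => exact hP.1

end Performance

end WorstCase

open WorstCase

theorem theorem2 {m : ℕ} (v T : Fin m → ℕ)
    (𝒳 : ∀ i, Set (EuclideanSpace ℝ (Fin (v i))))
    -- the cost function, the constraints, the true and the sampling (or baseline) distributions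
    (h : (∀ i, Fin (T i) → 𝒳 i) → ℝ) (hh : Measurable h)
    (c : ∀ i, WorstCase.ModelConstraint (𝒳 i))
    (P₀ Q : ∀ i, Measure (𝒳 i))
    [∀ i, IsProbabilityMeasure (P₀ i)] [∀ i, IsProbabilityMeasure (Q i)]
    (hc : ∀ i, WorstCase.Regular (P₀ i) (Q i) (c i))
    -- the observations: `y i 0, y i 1, …` are drawn from `Q i`, all independent
    {Ω : Type*} [MeasurableSpace Ω] (μ : Measure Ω) [IsProbabilityMeasure μ]
    (y : ∀ i, ℕ → Ω → 𝒳 i) (hy : ∀ i j, Measurable (y i j))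
    (hlaw : ∀ i j, μ.map (y i j) = Q i)
    (hindep : iIndepFun (fun (p : Fin m × ℕ) => y p.1 p.2) μ)
    -- `h` is almost surely bounded on the arguments made up of sampled points
    (hbdd : ∃ M : ℝ, ∀ᵐ ω ∂μ, ∀ j : (∀ i, Fin (T i) → ℕ), |h fun i t => y i (j i t) ω| ≤ M)
    -- the sample sizes `N n i` are of the order `n`
    (N : ℕ → Fin m → ℕ) (C₁ C₂ : ℝ) (hC₁ : 0 < C₁)
    (hN : ∀ n : ℕ, 0 < n → ∀ i, C₁ ≤ (N n i : ℝ) / n ∧ (N n i : ℝ) / n ≤ C₂) :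
    ∃ R : ℕ → Ω → ℝ, (∀ n, Measurable (R n)) ∧
      WorstCase.IsBigOInProb μ R (fun n => 1 / √(n : ℝ)) ∧
      ∀ᵐ ω ∂μ, ∀ᶠ n in atTop,
        WorstCase.worstMin h
            (fun i => WorstCase.sampledSet (c i) (N n i) (fun j => y i j ω)) ≤
          ((WorstCase.perf h P₀ + R n ω : ℝ) : EReal) ∧
        ((WorstCase.perf h P₀ + R n ω : ℝ) : EReal) ≤
          WorstCase.worstMax h
            (fun i => WorstCase.sampledSet (c i) (N n i) (fun j => y i j ω)) := by
  have hac := fun i => (hc i).absolutelyContinuous_and_essSup_lt_top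
  choose ℓ B hℓ h0 hB hP hdens using fun i => exists_bounded_density (hac i).1 (hac i).2
  obtain ⟨K, hK1, hK⟩ : ∃ K : ℝ, 1 ≤ K ∧ ∀ i x, ℓ i x ≤ K :=
    ⟨1 + ∑ i, |B i|, le_add_of_nonneg_right (Finset.sum_nonneg fun i _ => abs_nonneg _),
      fun i x => ((hB i x).trans (le_abs_self _)).trans ((Finset.single_le_sum
        (f := fun i => |B i|) (fun i _ => abs_nonneg _) (Finset.mem_univ i)).trans
          (le_add_of_nonneg_left zero_le_one))⟩
  obtain ⟨M, hM0, hM⟩ : ∃ M : ℝ, 0 ≤ M ∧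
      ∀ᵐ ω ∂μ, ∀ j : (∀ i, Fin (T i) → ℕ), |h fun i t => y i (j i t) ω| ≤ M := by
    obtain ⟨M, hM⟩ := hbdd
    exact ⟨|M|, abs_nonneg M, hM.mono fun ω hω j => (hω j).trans (le_abs_self M)⟩
  have hperf := perf_eq_integral_truncCost hh hy hlaw hindep hM hℓ hP
  have hNlow : ∀ n : ℕ, 0 < n → ∀ i, C₁ * n ≤ N n i := fun n hn i =>
    (le_div_iff₀ (by exact_mod_cast hn)).1 (hN n hn i).1
  have hNtop : ∀ i, Tendsto (fun n => N n i) atTop atTop := fun i => by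
    rw [← tendsto_natCast_atTop_iff (R := ℝ)]
    refine tendsto_atTop_mono' _ ?_ (tendsto_natCast_atTop_atTop.const_mul_atTop hC₁)
    filter_upwards [eventually_gt_atTop 0] with n hn using hNlow n hn i
  let S := Σ i, Fin (T i)
  obtain ⟨C, hC0, hC⟩ := integral_tilted_vStat_sub_sq_le hy hlaw hindep (Sigma.fst : S → Fin m)
    hℓ h0 hK hK1 hP (measurable_truncCost hh M) hM0 (abs_truncCost_le (X := fun i => 𝒳 i) hM0)
  rw [← hperf] at hC
  refine ⟨fun n ω => vStat (fun s : S => N n s.1) (fun s j => y s.1 j ω)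
    (fun x => (∏ s : S, tilt (ℓ s.1) (N n s.1) (fun j => y s.1 j ω) (x s)) * truncCost h M x) -
      perf h P₀, fun n => ?_, ?_, ?_⟩
  · exact (measurable_tilted_vStat hy (Sigma.fst : S → Fin m) hℓ (measurable_truncCost hh M)
      _).sub_const _
  · have hr : ∀ n : ℕ, 0 < n → 0 < C₁ * n := fun n hn => mul_pos hC₁ (by exact_mod_cast hn)
    refine isBigOInProb_of_integral_sq_le (C := C / C₁) (by positivity)
      (fun n hn => (hC (fun s => N n s.1) _ (hr n hn) fun s => hNlow n hn s.1).1) fun n hn => ?_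
    rw [div_div]
    exact (hC (fun s => N n s.1) _ (hr n hn) fun s => hNlow n hn s.1).2
  · have hmem := ae_all_iff.2 fun i => ae_eventually_tilted_mem hy hlaw hindep i (hc i) (hℓ i)
      (h0 i) (hB i) (hP i) (hdens i)
    filter_upwards [hM, hmem] with ω hMω hω
    filter_upwards [eventually_all.2 fun i => (hNtop i).eventually (hω i),
      eventually_all.2 fun i => (hNtop i).eventually (eventually_ne_atTop 0)] with n hn hN0
    have hval := perf_tilted (z := fun i j => y i j ω) hh hℓ hN0 (fun i => (hn i).1)
      (fun i => isProbabilityMeasure_of_mem_sampledSet (hn i).2) hMω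
    rw [add_sub_cancel, ← hval]
    exact ⟨iInf₂_le (fun i => tilted (ℓ i) (N n i) fun j => y i j ω) fun i => (hn i).2,
      le_iSup₂ (f := fun (P : ∀ i, Measure (𝒳 i)) _ => (perf h P : EReal))
        (fun i => tilted (ℓ i) (N n i) fun j => y i j ω) fun i => (hn i).2⟩
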